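/- All languages are sets of words over $\{0,1\}$; ${\rm DP}=\{L_1\setminus L_2 : L_1,L_2\in{\rm NP}\}$, and ${\rm co}\mathcal C=\{L : \overline L\in\mathcal C\}$. Let ${\rm P}^{{\rm NP}[1]}$ be the class of languages accepted by a deterministic polynomial-time oracle Turing machine (whose time bound does not depend on the oracle) that, with some oracle $A\in{\rm NP}$, makes at most one query on each input. A function $f:\{0,1\}^*\to\{0,1\}^*$ is in ${\rm NPSV_t}$ if there is a nondeterministic polynomial-time Turing machine that on each input $x$ has at least one accepting path and on every accepting path outputs $f(x)$. Write $A\le^{\mathcal{SN}}_{1\text{-}tt}B$ if some function in ${\rm NPSV_t}$ computes from each $x$ a word $y_x$ and (the truth table of) a predicate $\alpha_x$ of one Boolean variable such that $x\in A\iff\alpha_x(\chi_B(y_x))$, and let ${\rm R}^{\mathcal{SN}}_{1\text{-}tt}({\rm NP})=\{L : (\exists B\in{\rm NP})\,[L\le^{\mathcal{SN}}_{1\text{-}tt}B]\}$. Corollary. $${\rm P}^{{\rm NP}[1]}\subseteq {\rm R}^{\mathcal{SN}}_{1\text{-}tt}({\rm NP})\subseteq{\rm DP}.$$ Moreover, ${\rm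 R}^{\mathcal{SN}}_{1\text{-}tt}({\rm NP})$ is closed under complement, and hence ${\rm R}^{\mathcal{SN}}_{1\text{-}tt}({\rm NP})\subseteq{\rm DP}\cap{\rm coDP}$. -/

import Mathlib

namespace SNReduction

/-! Strings over `{0,1}` are `List Bool`; languages are sets of strings; classes are sets of
languages. -/

/-- A word over `{0,1}`. -/
abbrev Word := List Bool

/-- A language over `{0,1}`. -/
abbrev Lang := Set Word

/-- A complexity class. -/
abbrev LangClass := Set Lang

/-- The role of a state of a machine. Computations stop in accepting and rejecting states. -/
inductive StateKind where
  | work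
  | query
  | accept
  | reject

/-- A (nondeterministic) multitape oracle Turing machine.

The tapes are two-way infinite, indexed by the finite type `K`, and carry the symbols `0`, `1` and
blank (`none`). A larger tape alphabet would add nothing, since a symbol of it can be held in
parallel on several tapes whose heads move together. There is one distinguished tape each for
input, output and oracle queries; these are ordinary read-write tapes.

In a work state `q`, when `s k` is the symbol scanned on tape `k`, the machine may choose any element
`(q', a)` of `δ q s`: it enters the state `q'` and, on each tape `k`, writes the symbol `(a k).1` and
moves the head according to `(a k).2` (`none` means that the head stays). If `δ q s` is empty, the
computation stops without accepting. In a query state `q` the next state is `answer q b`, where `b` is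
the answer of the oracle to the word on the query tape. -/
structure Machine where
  K : Type
  finK : Finite K
  Q : Type
  finQ : Finite Q
  input : K
  output : K
  queryTape : K
  start : Q
  kind : Q → StateKind
  δ : Q → (K → Option Bool) → Set (Q × (K → Option Bool × Option Turing.Dir))
  answer : Q → Bool → Q

/-- The word on a tape: it begins in the scanned cell and extends to the right up to, and not
including, the first blank cell. -/
def Holds (T : Turing.Tape (Option Bool)) (w : Word) : Prop :=
  ∀ i : ℕ, i ≤ w.length → T.nth i = w[i]?

/-- Write a symbol in the scanned cell, then move the head. -/
def act (T : Turing.Tape (Option Bool)) (a : Option Bool × Option Turing.Dir) :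
    Turing.Tape (Option Bool) :=
  match a.2 with
  | none => T.write a.1
  | some d => (T.write a.1).move d

namespace Machine

/-- A configuration: the state, and the contents of the tapes together with the head positions. -/
structure Cfg (M : Machine) where
  state : M.Q
  tape : M.K → Turing.Tape (Option Bool)

open Classical in
/-- The initial configuration: the word `x` is on the input tape, with the head on its first symbol,
and all other tapes are blank. -/
noncomputable def init (M : Machine) (x : Word) : M.Cfg where
  state := M.start
  tape k := if k = M.input then Turing.Tape.mk₁ (x.map some) else Turing.Tape.mk₁ []

/-- One step that does not involve the oracle. -/
def WorkStep (M : Machine) (c c' : M.Cfg) : Prop :=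
  M.kind c.state = StateKind.work ∧
    ∃ a : M.K → Option Bool × Option Turing.Dir,
      (c'.state, a) ∈ M.δ c.state (fun k => (c.tape k).head) ∧
      ∀ k, c'.tape k = act (c.tape k) (a k)

/-- One step in which the oracle `A` is queried. -/
def QueryStep (M : Machine) (A : Lang) (c c' : M.Cfg) : Prop :=
  M.kind c.state = StateKind.query ∧
    ∃ (w : Word) (b : Bool), Holds (c.tape M.queryTape) w ∧ (b = true ↔ w ∈ A) ∧
      c'.state = M.answer c.state b ∧ c'.tape = c.tape

/-- `M.Run A c t m c'`: with oracle `A` the machine can pass from `c` to `c'` in exactly `t` steps,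
exactly `m` of which are oracle queries. -/
inductive Run (M : Machine) (A : Lang) : M.Cfg → ℕ → ℕ → M.Cfg → Prop
  | refl (c : M.Cfg) : Run M A c 0 0 c
  | work {c c' c'' : M.Cfg} {t m : ℕ} :
      M.WorkStep c c' → Run M A c' t m c'' → Run M A c (t + 1) m c''
  | query {c c' c'' : M.Cfg} {t m : ℕ} :
      M.QueryStep A c c' → Run M A c' t m c'' → Run M A c (t + 1) (m + 1) c''

/-- `c` is the last configuration of an accepting computation path of `M` with oracle `A` on
input `x`. -/
def AcceptsAt (M : Machine) (A : Lang) (x : Word) (c : M.Cfg) : Prop :=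
  M.kind c.state = StateKind.accept ∧ ∃ t m, M.Run A (M.init x) t m c

/-- The language accepted by `M` with oracle `A`. -/
def language (M : Machine) (A : Lang) : Lang := {x | ∃ c, M.AcceptsAt A x c}

/-- Some polynomial in the length of the input bounds the length of all computation paths, whatever
the oracle is. -/
def PolyTime (M : Machine) : Prop :=
  ∃ p : Polynomial ℕ, ∀ (A : Lang) (x : Word) (t m : ℕ) (c : M.Cfg),
    M.Run A (M.init x) t m c → t ≤ p.eval x.length

/-- At most one action is possible in each situation. -/
def Deterministic (M : Machine) : Prop := ∀ q s, (M.δ q s).Subsingleton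

/-- The machine does not use an oracle. -/
def OracleFree (M : Machine) : Prop := ∀ q, M.kind q ≠ StateKind.query

end Machine

/-- The class NP. -/
def NP : LangClass :=
  {L | ∃ N : Machine, N.OracleFree ∧ N.PolyTime ∧ L = N.language ∅}

/-- The class DP of differences of two NP sets. -/
def DP : LangClass := {L | ∃ L₁ ∈ NP, ∃ L₂ ∈ NP, L = L₁ \ L₂}

/-- The class of complements of the members of a class. -/
def co (C : LangClass) : LangClass := {L | Lᶜ ∈ C}

/-- The class P^{C[1]}: the languages accepted by deterministic polynomial-time oracle machines
that, with some oracle in `C`, make at most one query on each input. -/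
def POneQuery (C : LangClass) : LangClass :=
  {L | ∃ A ∈ C, ∃ M : Machine, M.Deterministic ∧ M.PolyTime ∧
    (∀ (x : Word) (t m : ℕ) (c : M.Cfg), M.Run A (M.init x) t m c → m ≤ 1) ∧
    L = M.language A}

/-- The total single-valued functions that are computable in nondeterministic polynomial time:
some path accepts with output `f x`, and every accepting path has the output `f x`. -/
def NPSVt : Set (Word → Word) :=
  {f | ∃ N : Machine, N.OracleFree ∧ N.PolyTime ∧ ∀ x,
    (∃ c, N.AcceptsAt ∅ x c ∧ Holds (c.tape N.output) (f x)) ∧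
    (∀ c, N.AcceptsAt ∅ x c → Holds (c.tape N.output) (f x))}

/-- A self-delimiting code of a word: `1b` for each bit `b`, and then `0`. -/
def delimit : Word → Word
  | [] => [false]
  | b :: w => true :: b :: delimit w

/-- A code of a tuple of words: all of them but the last are delimited. -/
def tupleCode : List Word → Word
  | [] => []
  | [w] => w
  | w :: v :: l => delimit w ++ tupleCode (v :: l)

/-- The truth table of a `k`-ary predicate, as a word of length `2 ^ k`: its entry number `n` is the
value at the assignment that gives the variable `j` the binary digit number `j` of `n`. -/
def tableCode {k : ℕ} (α : (Fin k → Bool) → Bool) : Word :=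
  List.ofFn fun n : Fin (2 ^ k) => α fun j => n.val.testBit j.val

open Classical in
/-- The characteristic function of a language. -/
noncomputable def chi (B : Lang) (w : Word) : Bool := decide (w ∈ B)

/-- `k`-truth-table strong nondeterministic reducibility of `A` to `B`: a function in `NPSVt`
computes from `x` (codes of) a `k`-ary predicate `α x` and `k` words `y x 0, …, y x (k - 1)`
such that `x ∈ A` if and only if `α x` holds for the membership of these words in `B`. -/
def SNttReducible (k : ℕ) (A B : Lang) : Prop :=
  ∃ (y : Word → Fin k → Word) (α : Word → (Fin k → Bool) → Bool),
    (fun x => tableCode (α x) ++ tupleCode (List.ofFn (y x))) ∈ NPSVt ∧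
    ∀ x, x ∈ A ↔ α x (fun i => chi B (y x i)) = true

/-- The class of languages that are `k`-truth-table strong nondeterministically reducible to a
member of `C`. -/
def RSNtt (k : ℕ) (C : LangClass) : LangClass := {L | ∃ B ∈ C, SNttReducible k L B}

end SNReduction

namespace SNReduction

open Turing Sum

/-! ### Iteration of a relation -/

/-! A predicate of one Boolean variable is a pair of bits, its values at "no" and at "yes", so a
reduction amounts to a total single-valued function that outputs two bits followed by a word `y x`.

Closure under complement: flip both bits and keep the query word and the NP set (`compl_mem_RSNtt`).
Applying the inclusion in DP to the complement as well gives DP ∩ coDP.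

Inclusion in DP: the pair of bits is one of four cases, constant false, constant true, the identity
or negation. Let the first set ask whether `y x ∈ B` for the identity and accept outright when the
bit for "no" is set; let the second ask whether `y x ∈ B` for negation only. Their difference is the
given language (`RSNtt_one_subset_DP`). Both sets are in NP: guess a path of the machine for the
function, read the two bits, and run a machine for `B` on the word if needed (`setOf_mem_NP`).

Inclusion of the one-query class: a deterministic machine can be simulated without its oracle under
each of the two possible answers to its first query. The two verdicts are the bits, the queried word
is `y x`, and the oracle set itself serves as `B` (`POneQuery_subset_RSNtt`).

The rest is machine construction. Programs are built from procedures with several exits by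
sequential composition. For each, the possible results are characterised by an equivalence, which is
what preserves single-valuedness, and the time is bounded on all paths. -/

/-- `Iter r a n b`: one can pass from `a` to `b` in exactly `n` steps of the relation `r`. -/
inductive Iter {α : Type*} (r : α → α → Prop) : α → ℕ → α → Prop
  | refl (a : α) : Iter r a 0 a
  | head {a b c : α} {n : ℕ} : r a b → Iter r b n c → Iter r a (n + 1) c

namespace Iter

variable {α β : Type*} {r : α → α → Prop} {s : β → β → Prop}

theorem trans {a b c : α} {m n : ℕ} (h : Iter r a m b) (h' : Iter r b n c) :
    Iter r a (m + n) c := by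
  induction h with
  | refl => simpa using h'
  | head hr _ ih =>
    rw [Nat.add_right_comm]
    exact .head hr (ih h')

theorem of_map (φ : α → β) (H : ∀ a d, s (φ a) d → ∃ b, d = φ b ∧ r a b) {a : α} {n : ℕ} {d : β}
    (h : Iter s (φ a) n d) : ∃ b, d = φ b ∧ Iter r a n b := by
  generalize hx : φ a = x at h
  induction h generalizing a with
  | refl => exact ⟨a, hx.symm, .refl a⟩
  | head hr _ ih =>
    subst hx
    obtain ⟨b, rfl, hb⟩ := H _ _ hr
    obtain ⟨c, hc, h'⟩ := ih rfl
    exact ⟨c, hc, .head hb h'⟩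

theorem map (φ : α → β) (H : ∀ a b, r a b → s (φ a) (φ b)) {a b : α} {n : ℕ}
    (h : Iter r a n b) : Iter s (φ a) n (φ b) := by
  induction h with
  | refl => exact .refl _
  | head hr _ ih => exact .head (H _ _ hr) ih

/-- If `r` is deterministic, a computation that ends in a terminal element is longer than all
others from the same element, and it is the only one that ends in a terminal element. -/
theorem unique (hr : ∀ a b c, r a b → r a c → b = c) {a b z : α} {m n : ℕ} (h : Iter r a n z)
    (hz : ∀ c, ¬ r z c) (h' : Iter r a m b) : m ≤ n ∧ ((∀ c, ¬ r b c) → b = z) := by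
  induction h generalizing m with
  | refl =>
    cases h' with
    | refl => simp
    | head h1 _ => exact absurd h1 (hz _)
  | head h1 _ ih =>
    cases h' with
    | refl => exact ⟨Nat.zero_le _, fun H => absurd h1 (H _)⟩
    | head h2 h3 =>
      obtain rfl := hr _ _ _ h1 h2
      obtain ⟨h4, h5⟩ := ih hz h3
      exact ⟨Nat.succ_le_succ h4, h5⟩

/-- A path can be prolonged until it is stuck, and the bound leaves one step fewer each time. It
supplies the halting configurations of polynomial-time machines. -/
theorem exists_terminal {a : α} {N : ℕ} (h : ∀ n b, Iter r a n b → n ≤ N) :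
    ∃ n z, Iter r a n z ∧ ∀ c, ¬ r z c := by
  induction N generalizing a with
  | zero =>
    refine ⟨0, a, .refl a, fun c hc => ?_⟩
    have := h 1 c (.head hc (.refl c))
    omega
  | succ N ih =>
    by_cases ha : ∃ b, r a b
    · obtain ⟨b, hb⟩ := ha
      obtain ⟨n, z, hz, hz'⟩ := ih (a := b) fun n c hc => by
        have := h (n + 1) c (.head hb hc)
        omega
      exact ⟨n + 1, z, .head hb hz, hz'⟩
    · exact ⟨0, a, .refl a, fun c hc => ha ⟨c, hc⟩⟩

end Iter

/-! ### Tapes -/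

/-- The contents of tapes, together with the head positions. -/
abbrev Tapes (K : Type) := K → Tape (Option Bool)

open Classical in
/-- The word `x` on the tape `i`, all other tapes being blank. -/
noncomputable def initTapes {K : Type} (i : K) (x : Word) : Tapes K :=
  fun k => if k = i then Tape.mk₁ (x.map some) else Tape.mk₁ []

/-- The scanned symbols. -/
abbrev Tapes.scan {K : Type} (T : Tapes K) : K → Option Bool := fun k => (T k).head

/-- The effect of an action on every tape. -/
abbrev Tapes.act {K : Type} (T : Tapes K) (a : K → Option Bool × Option Dir) : Tapes K :=
  fun k => SNReduction.act (T k) (a k)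

/-- The action that changes nothing when the symbols `s` are scanned. -/
abbrev idle {K : Type} (s : K → Option Bool) : K → Option Bool × Option Dir := fun k => (s k, none)

@[simp]
theorem act_idle (T : Tape (Option Bool)) : act T (T.head, none) = T := by simp [act]

theorem Tapes.act_idle {K : Type} (T : Tapes K) : T.act (idle T.scan) = T :=
  funext fun _ => SNReduction.act_idle _

/-- `Holds` includes the blank just after the word, so the longer of two words would have a symbol
where the shorter has its final blank. -/
theorem Holds.unique {T : Tape (Option Bool)} {v w : Word} (hv : Holds T v) (hw : Holds T w) :
    v = w := by
  have key : ∀ {v w : Word}, Holds T v → Holds T w → v.length ≤ w.length := by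
    intro v w hv hw
    by_contra! hlt
    have h1 := hv w.length hlt.le
    rw [hw w.length le_rfl] at h1
    simp [hlt] at h1
  have hlen := le_antisymm (key hv hw) (key hw hv)
  refine List.ext_getElem? fun i => ?_
  by_cases hi : i ≤ v.length
  · rw [← hv i hi, ← hw i (hlen ▸ hi)]
  · rw [List.getElem?_eq_none (by omega), List.getElem?_eq_none (by omega)]

theorem holds_nil {T : Tape (Option Bool)} : Holds T [] ↔ T.head = none := by
  simp [Holds]

theorem holds_cons {T : Tape (Option Bool)} {b : Bool} {w : Word} :
    Holds T (b :: w) ↔ T.head = some b ∧ Holds (T.move Dir.right) w := by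
  constructor
  · intro h
    refine ⟨by simpa using h 0 (by simp), fun i hi => ?_⟩
    simpa using h (i + 1) (by simpa using hi)
  · rintro ⟨h0, h⟩ i hi
    cases i with
    | zero => simpa using h0
    | succ i => simpa using h i (by simpa using hi)

theorem Holds.prepend {T : Tape (Option Bool)} {w : Word} (h : Holds T w) (b : Bool) :
    Holds ((T.move Dir.left).write (some b)) (b :: w) := by
  intro i hi
  cases i with
  | zero => simp [Tape.write]
  | succ i =>
    have : (i : ℤ) + 1 ≠ 0 := by omega
    simpa [this] using h i (by simpa using hi)

/-- Only finitely many cells of a tape are not blank, so reading to the right meets a blank. Hence a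
query state always has a word to ask about. -/
theorem holds_exists (T : Tape (Option Bool)) : ∃ w, Holds T w := by
  have key : ∀ (r : List (Option Bool)) (L : ListBlank (Option Bool)),
      ∃ w, Holds (Tape.mk' L (ListBlank.mk r)) w := by
    intro r
    induction r with
    | nil => exact fun L => ⟨[], holds_nil.2 rfl⟩
    | cons a r ih =>
      intro L
      cases a with
      | none => exact ⟨[], holds_nil.2 rfl⟩
      | some b =>
        obtain ⟨w, hw⟩ := ih (L.cons (some b))
        exact ⟨b :: w, holds_cons.2 ⟨rfl, by simpa using hw⟩⟩
  obtain ⟨L, R, rfl⟩ := Tape.exists_mk' T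
  induction R using ListBlank.induction_on with
  | _ r => exact key r L

theorem holds_mk₁ (w : Word) : Holds (Tape.mk₁ (w.map some)) w := by
  intro i _
  simp [Tape.mk₁, Tape.mk₂, ListBlank.nth_mk, List.getI_eq_getElem?_getD]
  cases w[i]? <;> rfl

/-- The tape has at most `n` cells that are not blank, even counting the blank cells between them
and the head. -/
def Fits (T : Tape (Option Bool)) (n : ℕ) : Prop :=
  ∃ l r : List (Option Bool), T = Tape.mk₂ l r ∧ l.length + r.length ≤ n

theorem Fits.mono {T : Tape (Option Bool)} {m n : ℕ} (h : Fits T m) (hmn : m ≤ n) : Fits T n := by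
  obtain ⟨l, r, h1, h2⟩ := h
  exact ⟨l, r, h1, h2.trans hmn⟩

/-- Writing can extend an empty right half by one cell, and the move can take in one further cell;
hence at most 2 per step. -/
theorem Fits.act {T : Tape (Option Bool)} {n : ℕ} (h : Fits T n)
    (a : Option Bool × Option Dir) : Fits (act T a) (n + 2) := by
  obtain ⟨l, r, rfl, h⟩ := h
  obtain ⟨b, d⟩ := a
  have hw : (Tape.mk₂ l r).write b = Tape.mk₂ l (b :: r.tail) := by
    simp [Tape.mk₂]
  have hr : r.tail.length ≤ r.length := by simp
  rcases d with _ | _ | _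
  · exact ⟨l, b :: r.tail, hw, by simp only [List.length_cons]; omega⟩
  · refine ⟨l.tail, l.headI :: b :: r.tail, ?_, ?_⟩
    · simp only [SNReduction.act, hw]
      simp [Tape.mk₂]
    · have : l.tail.length ≤ l.length := by simp
      simp only [List.length_cons]; omega
  · refine ⟨b :: l, r.tail, ?_, by simp only [List.length_cons]; omega⟩
    simp only [SNReduction.act, hw]
    simp [Tape.mk₂]

theorem Fits.length_le {T : Tape (Option Bool)} {n : ℕ} (h : Fits T n) {w : Word}
    (hw : Holds T w) : w.length ≤ n := by
  obtain ⟨l, r, rfl, h⟩ := h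
  by_contra! hlt
  have h1 := hw r.length (by omega)
  simp [Tape.mk₂, ListBlank.nth_mk, List.getI_eq_getElem?_getD,
    List.getElem?_eq_getElem (show r.length < w.length by omega)] at h1

theorem fits_initTapes {K : Type} (i : K) (x : Word) (k : K) : Fits (initTapes i x k) x.length := by
  unfold initTapes
  split_ifs
  · exact ⟨[], x.map some, rfl, by simp⟩
  · exact ⟨[], [], rfl, by simp⟩

/-! ### Procedures -/

/-- A nondeterministic procedure on the tapes `K`, with exits `E`. -/
structure Proc (K E : Type) where
  Q : Type
  finQ : Finite Q
  start : Q
  δ : Q → (K → Option Bool) → Set ((Q ⊕ E) × (K → Option Bool × Option Dir))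

namespace Proc

variable {K E F : Type}

/-- One step of a procedure. -/
def Step (P : Proc K E) (c c' : (P.Q ⊕ E) × Tapes K) : Prop :=
  ∃ q a, c.1 = inl q ∧ (c'.1, a) ∈ P.δ q c.2.scan ∧ c'.2 = c.2.act a

/-- Started on the tapes `T`, the procedure can leave through the exit `e` with the tapes `T'`. -/
def Exec (P : Proc K E) (T : Tapes K) (e : E) (T' : Tapes K) : Prop :=
  ∃ n, Iter P.Step (inl P.start, T) n (inr e, T')

/-- Started on the tapes `T`, the procedure makes at most `n` steps. -/
def TimeLE (P : Proc K E) (T : Tapes K) (n : ℕ) : Prop :=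
  ∀ m c, Iter P.Step (inl P.start, T) m c → m ≤ n

theorem TimeLE.mono {P : Proc K E} {T : Tapes K} {m n : ℕ} (h : P.TimeLE T m) (hmn : m ≤ n) :
    P.TimeLE T n := fun _ _ hk => (h _ _ hk).trans hmn

theorem step_inl {P : Proc K E} {q : P.Q} {T : Tapes K} {c : (P.Q ⊕ E) × Tapes K} :
    P.Step (inl q, T) c ↔ ∃ a, (c.1, a) ∈ P.δ q T.scan ∧ c.2 = T.act a := by
  constructor
  · rintro ⟨q', a, h, h'⟩
    cases h
    exact ⟨a, h'⟩
  · rintro ⟨a, h⟩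
    exact ⟨q, a, rfl, h⟩

theorem not_step_inr {P : Proc K E} {e : E} {T : Tapes K} {c : (P.Q ⊕ E) × Tapes K} :
    ¬ P.Step (inr e, T) c := by
  rintro ⟨q, a, h, -⟩
  cases h

/-! #### Elementary procedures -/

/-- The procedure that gets stuck at once. -/
def fail : Proc K E where
  Q := Unit
  finQ := inferInstance
  start := ()
  δ _ _ := ∅

theorem exec_fail {T T' : Tapes K} {e : E} : ¬ (fail : Proc K E).Exec T e T' := by
  rintro ⟨n, h⟩
  cases h with
  | head h _ =>
    obtain ⟨a, h, -⟩ := step_inl.1 h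
    exact h

theorem timeLE_fail (T : Tapes K) (n : ℕ) : (fail : Proc K E).TimeLE T n := by
  intro m c h
  cases h with
  | refl => exact Nat.zero_le _
  | head h _ =>
    obtain ⟨a, h, -⟩ := step_inl.1 h
    exact h.elim

/-- The procedure that takes a single step, which depends on the scanned symbols. -/
def single (g : (K → Option Bool) → E × (K → Option Bool × Option Dir)) : Proc K E where
  Q := Unit
  finQ := inferInstance
  start := ()
  δ _ s := {(inr (g s).1, (g s).2)}

section single

variable {g : (K → Option Bool) → E × (K → Option Bool × Option Dir)}

theorem single_step {T : Tapes K} {c : Unit ⊕ E} {T' : Tapes K} :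
    (single g).Step (inl (), T) (c, T') ↔ c = inr (g T.scan).1 ∧ T' = T.act (g T.scan).2 := by
  refine step_inl.trans ⟨?_, ?_⟩
  · rintro ⟨a, h, h'⟩
    obtain ⟨h1, h2⟩ := Prod.ext_iff.1 (Set.mem_singleton_iff.1 h)
    exact ⟨h1, h2 ▸ h'⟩
  · rintro ⟨rfl, rfl⟩
    exact ⟨_, rfl, rfl⟩

theorem exec_single {T T' : Tapes K} {e : E} :
    (single g).Exec T e T' ↔ e = (g T.scan).1 ∧ T' = T.act (g T.scan).2 := by
  constructor
  · rintro ⟨n, h⟩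
    cases h with
    | @head _ c _ _ h h' =>
      obtain ⟨c, S⟩ := c
      obtain ⟨rfl, rfl⟩ := single_step.1 h
      cases h' with
      | refl => exact ⟨rfl, rfl⟩
      | head h' _ => exact absurd h' not_step_inr
  · rintro ⟨rfl, rfl⟩
    exact ⟨1, .head (single_step.2 ⟨rfl, rfl⟩) (.refl _)⟩

theorem timeLE_single (T : Tapes K) : (single g).TimeLE T 1 := by
  intro m c h
  cases h with
  | refl => exact Nat.zero_le _
  | @head _ c _ _ h h' =>
    obtain ⟨c, S⟩ := c
    obtain ⟨rfl, rfl⟩ := single_step.1 h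
    cases h' with
    | refl => exact le_rfl
    | head h' _ => exact absurd h' not_step_inr

end single

/-- The procedure that does nothing but leave through the exit `e`. -/
def ret (e : E) : Proc K E := single fun s => (e, idle s)

theorem exec_ret {T T' : Tapes K} {e e' : E} : (ret e).Exec T e' T' ↔ e' = e ∧ T' = T := by
  rw [ret, exec_single, Tapes.act_idle]

theorem timeLE_ret (T : Tapes K) (e : E) : (ret e).TimeLE T 1 := timeLE_single T

open Classical in
/-- The procedure that takes a single step, which involves only the tape `k`. -/
noncomputable def onTape (k : K) (g : Option Bool → E × (Option Bool × Option Dir)) : Proc K E :=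
  single fun s => ((g (s k)).1, Function.update (idle s) k (g (s k)).2)

theorem exec_onTape [DecidableEq K] {k : K}
    {g : Option Bool → E × (Option Bool × Option Dir)} {T T' : Tapes K} {e : E} : (onTape k g).Exec T e T' ↔
      e = (g (T k).head).1 ∧ T' = Function.update T k (act (T k) (g (T k).head).2) := by
  rw [onTape, exec_single]
  refine and_congr_right fun _ => Eq.congr_right (funext fun j => ?_)
  by_cases hj : j = k
  · subst hj; simp [Tapes.act]
  · simp [Tapes.act, hj]

theorem timeLE_onTape {k : K} {g : Option Bool → E × (Option Bool × Option Dir)} (T : Tapes K) :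
    (onTape k g).TimeLE T 1 := timeLE_single T

/-! #### Sequential composition -/

/-- The procedure that runs `P`, and then `R e` if `P` has left through the exit `e`. -/
def seq [Finite E] (P : Proc K E) (R : E → Proc K F) : Proc K F where
  Q := P.Q ⊕ Σ e, (R e).Q
  finQ := by
    have := P.finQ
    have := fun e => (R e).finQ
    infer_instance
  start := inl P.start
  δ q s := match q with
    -- An exit of `P` is replaced by the start state of the next procedure, so the passage costs no
    -- step and the times simply add.
    | inl q => (fun p => (inl (p.1.map id fun e => ⟨e, (R e).start⟩), p.2)) '' P.δ q s
    | inr ⟨e, q⟩ => (fun p => (p.1.map (fun q' => inr ⟨e, q'⟩) id, p.2)) '' (R e).δ q s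

section seq

variable [Finite E] {P : Proc K E} {R : E → Proc K F}

/-- A configuration of the first procedure as one of the composition. -/
def seqFst (P : Proc K E) (R : E → Proc K F) (c : (P.Q ⊕ E) × Tapes K) :
    ((P.seq R).Q ⊕ F) × Tapes K :=
  (inl (c.1.map id fun e => ⟨e, (R e).start⟩), c.2)

/-- A configuration of the second procedure as one of the composition. -/
def seqSnd (P : Proc K E) (R : E → Proc K F) (e : E) (c : ((R e).Q ⊕ F) × Tapes K) :
    ((P.seq R).Q ⊕ F) × Tapes K :=
  (c.1.map (fun q => inr ⟨e, q⟩) id, c.2)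

theorem seqFst_step {q : P.Q} {T : Tapes K} {d : ((P.seq R).Q ⊕ F) × Tapes K} :
    (P.seq R).Step (seqFst P R (inl q, T)) d ↔ ∃ c, d = seqFst P R c ∧ P.Step (inl q, T) c := by
  refine (step_inl (P := P.seq R) (q := inl q)).trans ⟨?_, ?_⟩
  · rintro ⟨a, ⟨⟨c, a'⟩, hc, h⟩, h'⟩
    obtain ⟨h1, h2⟩ := Prod.ext_iff.1 h
    obtain rfl : a' = a := h2
    exact ⟨(c, T.act a'), Prod.ext h1.symm h', step_inl.2 ⟨_, hc, rfl⟩⟩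
  · rintro ⟨c, rfl, h⟩
    obtain ⟨a, h1, h2⟩ := step_inl.1 h
    exact ⟨a, ⟨_, h1, rfl⟩, h2⟩

theorem seqSnd_step {e : E} {c : ((R e).Q ⊕ F) × Tapes K} {d : ((P.seq R).Q ⊕ F) × Tapes K} :
    (P.seq R).Step (seqSnd P R e c) d ↔ ∃ c', d = seqSnd P R e c' ∧ (R e).Step c c' := by
  obtain ⟨q | f, T⟩ := c
  · refine (step_inl (P := P.seq R) (q := inr ⟨e, q⟩)).trans ⟨?_, ?_⟩
    · rintro ⟨a, ⟨⟨c, a'⟩, hc, h⟩, h'⟩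
      obtain ⟨h1, h2⟩ := Prod.ext_iff.1 h
      obtain rfl : a' = a := h2
      exact ⟨(c, T.act a'), Prod.ext h1.symm h', step_inl.2 ⟨_, hc, rfl⟩⟩
    · rintro ⟨c, rfl, h⟩
      obtain ⟨a, h1, h2⟩ := step_inl.1 h
      exact ⟨a, ⟨_, h1, rfl⟩, h2⟩
  · exact iff_of_false not_step_inr fun ⟨c', _, h⟩ => not_step_inr h

/-- The image of an exit configuration of `P` is also the image of the initial configuration of `R
e`. A run of the composition thus either stays within `P` or splits at that configuration. -/
theorem seqFst_iter {c : (P.Q ⊕ E) × Tapes K} {n : ℕ} {d : ((P.seq R).Q ⊕ F) × Tapes K}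
    (h : Iter (P.seq R).Step (seqFst P R c) n d) :
    (∃ c', d = seqFst P R c' ∧ Iter P.Step c n c') ∨
      ∃ e T m k, n = m + k ∧ Iter P.Step c m (inr e, T) ∧
        ∃ c', d = seqSnd P R e c' ∧ Iter (R e).Step (inl (R e).start, T) k c' := by
  generalize hx : seqFst P R c = x at h
  induction h generalizing c with
  | refl => exact .inl ⟨c, hx.symm, .refl c⟩
  | @head a b c₁ n hr h' ih =>
    subst hx
    obtain ⟨q | e, T⟩ := c
    · obtain ⟨c, rfl, hc⟩ := seqFst_step.1 hr
      obtain ⟨c', h1, h2⟩ | ⟨e, T', m, k, h1, h2, h3⟩ := ih rfl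
      · exact .inl ⟨c', h1, .head hc h2⟩
      · exact .inr ⟨e, T', m + 1, k, by omega, .head hc h2, h3⟩
    · refine .inr ⟨e, T, 0, n + 1, by omega, .refl _, ?_⟩
      exact Iter.of_map (seqSnd P R e) (fun a d h => seqSnd_step.1 h) (a := (inl (R e).start, T))
        (.head hr h')

theorem exec_seq {T T' : Tapes K} {f : F} :
    (P.seq R).Exec T f T' ↔ ∃ e S, P.Exec T e S ∧ (R e).Exec S f T' := by
  constructor
  · rintro ⟨n, h⟩
    obtain ⟨c', h1, h2⟩ | ⟨e, S, m, k, h1, h2, c', h3, h4⟩ :=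
      seqFst_iter (c := (inl P.start, T)) h
    · cases (Prod.ext_iff.1 h1).1
    · obtain ⟨q | f', S'⟩ := c'
      · cases (Prod.ext_iff.1 h3).1
      · cases h3
        exact ⟨e, S, ⟨m, h2⟩, ⟨k, h4⟩⟩
  · rintro ⟨e, S, ⟨m, h⟩, ⟨k, h'⟩⟩
    have h1 : Iter (P.seq R).Step (seqFst P R (inl P.start, T)) m (seqFst P R (inr e, S)) := by
      refine Iter.map _ (fun a b hab => ?_) h
      obtain ⟨q | e, T⟩ := a
      · exact seqFst_step.2 ⟨_, rfl, hab⟩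
      · exact absurd hab not_step_inr
    have h2 := Iter.map (seqSnd P R e) (fun a b hab => seqSnd_step.2 ⟨_, rfl, hab⟩) h'
    exact ⟨m + k, h1.trans h2⟩

theorem timeLE_seq {T : Tapes K} {m n : ℕ} (hP : P.TimeLE T m)
    (hR : ∀ e S, P.Exec T e S → (R e).TimeLE S n) : (P.seq R).TimeLE T (m + n) := by
  intro k d h
  obtain ⟨c', -, h2⟩ | ⟨e, S, i, j, rfl, h2, c', -, h4⟩ := seqFst_iter (c := (inl P.start, T)) h
  · exact (hP _ _ h2).trans (Nat.le_add_right _ _)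
  · exact add_le_add (hP _ _ h2) (hR e S ⟨_, h2⟩ _ _ h4)

end seq

/-! #### Procedures as machines -/

/-- A procedure with one exit, through which it accepts, as a machine. -/
def toMachine [Finite K] (P : Proc K Unit) (i o : K) : Machine where
  K := K
  finK := inferInstance
  Q := P.Q ⊕ Unit
  finQ := by have := P.finQ; infer_instance
  input := i
  output := o
  -- The query tape and the answers are dummies, as no state is a query state.
  queryTape := i
  start := inl P.start
  kind q := q.elim (fun _ => .work) (fun _ => .accept)
  δ q s := q.elim (fun q => P.δ q s) (fun _ => ∅)
  answer q _ := q

section toMachine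

variable [Finite K] {P : Proc K Unit} {i o : K}

theorem toMachine_oracleFree : (P.toMachine i o).OracleFree := by
  rintro (q | q) h <;> cases h

theorem toMachine_workStep {c c' : (P.toMachine i o).Cfg} :
    (P.toMachine i o).WorkStep c c' ↔ P.Step (c.state, c.tape) (c'.state, c'.tape) := by
  obtain ⟨q | u, T⟩ := c
  · refine Iff.trans ?_ step_inl.symm
    constructor
    · rintro ⟨-, a, h1, h2⟩
      exact ⟨a, h1, funext h2⟩
    · rintro ⟨a, h1, h2⟩
      exact ⟨rfl, a, h1, congrFun h2⟩
  · refine iff_of_false ?_ not_step_inr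
    rintro ⟨h, -⟩
    cases h

theorem toMachine_run {A : Lang} {c c' : (P.toMachine i o).Cfg} {t m : ℕ}
    (h : (P.toMachine i o).Run A c t m c') :
    Iter P.Step (c.state, c.tape) t (c'.state, c'.tape) := by
  induction h with
  | refl => exact .refl _
  | work h _ ih => exact .head (toMachine_workStep.1 h) ih
  | query h _ _ => exact absurd h.1 (toMachine_oracleFree _)

theorem toMachine_polyTime (p : Polynomial ℕ)
    (h : ∀ x, P.TimeLE (initTapes i x) (p.eval x.length)) : (P.toMachine i o).PolyTime :=
  ⟨p, fun _ x _ _ _ hr => h x _ _ (toMachine_run hr)⟩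

theorem toMachine_acceptsAt {A : Lang} {x : Word} {c : (P.toMachine i o).Cfg} :
    (P.toMachine i o).AcceptsAt A x c ↔
      c.state = inr () ∧ P.Exec (initTapes i x) () c.tape := by
  obtain ⟨q | u, T⟩ := c
  · refine iff_of_false ?_ (by simp)
    rintro ⟨h, -⟩
    cases h
  · constructor
    · rintro ⟨-, t, m, h⟩
      exact ⟨rfl, t, toMachine_run h⟩
    · rintro ⟨-, t, h⟩
      refine ⟨rfl, t, 0, ?_⟩
      have key : ∀ {a b : (P.Q ⊕ Unit) × Tapes K} {t : ℕ}, Iter P.Step a t b →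
          (P.toMachine i o).Run A ⟨a.1, a.2⟩ t 0 ⟨b.1, b.2⟩ := by
        intro a b t h
        induction h with
        | refl => exact .refl _
        | head h _ ih => exact .work (toMachine_workStep.2 h) ih
      exact key h

end toMachine

end Proc

/-! ### Copying a word -/

namespace Proc

variable {K : Type}

@[simp]
-- Lets `simp` discard a written trailing blank, so that copies have the form of fresh tapes.
theorem mk_none : ListBlank.mk [(none : Option Bool)] = ListBlank.mk [] := by
  apply ListBlank.ext
  intro n
  cases n <;> rfl

open Classical in
/-- Copy the word on the tape `i` to all tapes in `D`, and move their heads back to the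
beginning of the copy. The tape `j` is one of `D`. -/
noncomputable def copy (i j : K) (D : Set K) : Proc K Unit where
  Q := Bool
  finQ := inferInstance
  start := true
  δ q s := match q with
    | true => match s i with
      | some b => {(inl true, fun k => if k ∈ D ∨ k = i then (some b, some Dir.right)
          else (s k, none))}
      | none => {(inl false, fun k => if k ∈ D then (none, some Dir.left) else (s k, none))}
    | false => match s j with
      | some b => {(inl false, fun k => if k ∈ D then (some b, some Dir.left) else (s k, none))}
      | none => {(inr (), fun k => if k ∈ D then (none, some Dir.right) else (s k, none))}

variable {i j : K} {D : Set K}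

theorem copy_step_unique {a b c : ((copy i j D).Q ⊕ Unit) × Tapes K}
    (hb : (copy i j D).Step a b) (hc : (copy i j D).Step a c) : b = c := by
  obtain ⟨q | u, T⟩ := a
  · obtain ⟨x, hx, hx'⟩ := step_inl.1 hb
    obtain ⟨y, hy, hy'⟩ := step_inl.1 hc
    have : ((copy i j D).δ q T.scan).Subsingleton := by
      unfold copy
      dsimp only
      split <;> split <;> exact Set.subsingleton_singleton
    obtain ⟨h1, h2⟩ := Prod.ext_iff.1 (this hx hy)
    dsimp only at h1 h2
    subst h2
    exact Prod.ext h1 (hx'.trans hy'.symm)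
  · exact absurd hb not_step_inr

open Classical in
-- The induction needs the part `l` already copied, stored in reverse as the left half of each
-- target tape. The blank ending the source turns the heads back.
theorem copy_forth : ∀ (w l : Word) (T : Tapes K), Holds (T i) w →
    (∀ k ∈ D, T k = Tape.mk₂ (l.map some) []) →
    ∃ T', Iter (copy i j D).Step (inl true, T) (w.length + 1) (inl false, T') ∧
      (∀ k ∈ D, T' k = (Tape.mk₂ ((w.reverse ++ l).map some) []).move Dir.left) ∧
      ∀ k ∉ D, k ≠ i → T' k = T k := by
  intro w
  induction w with
  | nil =>
    intro l T hT hD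
    refine ⟨_, .head (step_inl.2 ⟨fun k => if k ∈ D then (none, some Dir.left)
      else (T k |>.head, none), ?_, rfl⟩) (.refl _), ?_, ?_⟩
    · simp [copy, holds_nil.1 hT]; exact rfl
    · intro k hk
      have : T k = (T k).write none := by
        rw [hD k hk]; simp [Tape.mk₂]
      simp [hk, ← hD k hk, ← this]
    · intro k hk _
      simp [hk]
  | cons b w ih =>
    intro l T hT hD
    obtain ⟨h0, h1⟩ := holds_cons.1 hT
    set S : Tapes K := T.act fun k => if k ∈ D ∨ k = i then (some b, some Dir.right)
      else (T k |>.head, none) with hS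
    have hSi : S i = (T i).move Dir.right := by
      simp [hS, act, ← h0]
    obtain ⟨T', h2, h3, h4⟩ := ih (b :: l) S (by rwa [hSi]) (by
      intro k hk
      simp [hS, act, hk, hD k hk, Tape.mk₂])
    refine ⟨T', .head (step_inl.2 ⟨_, ?_, hS⟩) h2, ?_, ?_⟩
    · simp [copy, h0]; exact rfl
    · intro k hk
      rw [h3 k hk]; simp
    · intro k hk hki
      rw [h4 k hk hki]
      simp [hS, Tapes.act, hk, hki]

open Classical in
-- Here `l` is still to be passed and `r` has been passed. The tapes in `D` move in unison, so it is
-- enough to watch for the left end on one of them, `j`.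
theorem copy_back (hj : j ∈ D) : ∀ (l r : Word) (T : Tapes K),
    (∀ k ∈ D, T k = (Tape.mk₂ (l.map some) (r.map some)).move Dir.left) →
    ∃ T', Iter (copy i j D).Step (inl false, T) (l.length + 1) (inr (), T') ∧
      (∀ k ∈ D, T' k = Tape.mk₁ ((l.reverse ++ r).map some)) ∧ ∀ k ∉ D, T' k = T k := by
  intro l
  induction l with
  | nil =>
    intro r T hD
    refine ⟨_, .head (step_inl.2 ⟨fun k => if k ∈ D then (none, some Dir.right)
      else (T k |>.head, none), ?_, rfl⟩) (.refl _), ?_, ?_⟩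
    · have : (T j).head = none := by
        rw [hD j hj]; simp [Tape.mk₂]; rfl
      simp [copy, this]; exact rfl
    · intro k hk
      have : T k = (T k).write none := by
        rw [hD k hk]; simp [Tape.mk₂]; rfl
      change act (T k) (if k ∈ D then _ else _) = _
      rw [if_pos hk, act, ← this, hD k hk]
      simp [Tape.mk₁]
    · intro k hk
      simp [hk]
  | cons b l ih =>
    intro r T hD
    have hh : ∀ k ∈ D, T k = Tape.mk₂ (l.map some) ((b :: r).map some) := by
      intro k hk
      rw [hD k hk]; simp [Tape.mk₂]
    set S : Tapes K := T.act fun k => if k ∈ D then (some b, some Dir.left)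
      else (T k |>.head, none) with hS
    obtain ⟨T', h2, h3, h4⟩ := ih (b :: r) S (by
      intro k hk
      rw [← hh k hk]
      have : T k = (T k).write (some b) := by
        rw [hh k hk]; simp [Tape.mk₂]
      simp [hS, act, hk, ← this])
    refine ⟨T', .head (step_inl.2 ⟨_, ?_, hS⟩) h2, ?_, ?_⟩
    · have : (T j).head = some b := by
        rw [hh j hj]; simp [Tape.mk₂]
      simp [copy, this]; exact rfl
    · intro k hk
      rw [h3 k hk]; simp
    · intro k hk
      rw [h4 k hk]
      simp [hS, Tapes.act, hk]

/-- One step per symbol in each direction, and one for each of the two blanks met. As `copy` is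
deterministic, this single run determines both its time and its result. -/
theorem copy_run (hj : j ∈ D) {w : Word} {T : Tapes K} (hT : Holds (T i) w)
    (hD : ∀ k ∈ D, T k = Tape.mk₁ []) :
    ∃ T', Iter (copy i j D).Step (inl true, T) (2 * w.length + 2) (inr (), T') ∧
      (∀ k ∈ D, T' k = Tape.mk₁ (w.map some)) ∧ ∀ k ∉ D, k ≠ i → T' k = T k := by
  obtain ⟨S, h1, h2, h3⟩ := copy_forth (j := j) w [] T hT hD
  obtain ⟨T', h4, h5, h6⟩ := copy_back (i := i) hj w.reverse [] S (by simpa using h2)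
  refine ⟨T', ?_, by simpa using h5, fun k hk hki => (h6 k hk).trans (h3 k hk hki)⟩
  have := h1.trans h4
  rwa [show w.length + 1 + (w.reverse.length + 1) = 2 * w.length + 2 by
    rw [List.length_reverse]; omega] at this

theorem timeLE_copy (hj : j ∈ D) {w : Word} {T : Tapes K} (hT : Holds (T i) w)
    (hD : ∀ k ∈ D, T k = Tape.mk₁ []) : (copy i j D).TimeLE T (2 * w.length + 2) := by
  obtain ⟨T', h, -⟩ := copy_run hj hT hD
  exact fun m c hc => (h.unique (fun _ _ _ => copy_step_unique) (fun _ => not_step_inr) hc).1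

theorem exec_copy (hj : j ∈ D) {w : Word} {T : Tapes K} (hT : Holds (T i) w)
    (hD : ∀ k ∈ D, T k = Tape.mk₁ []) :
    ∃ T', (∀ u S, (copy i j D).Exec T u S ↔ S = T') ∧
      (∀ k ∈ D, T' k = Tape.mk₁ (w.map some)) ∧ ∀ k ∉ D, k ≠ i → T' k = T k := by
  obtain ⟨T', h, h'⟩ := copy_run hj hT hD
  refine ⟨T', fun u S => ⟨?_, ?_⟩, h'⟩
  · rintro ⟨n, hn⟩
    exact (Prod.ext_iff.1 ((h.unique (fun _ _ _ => copy_step_unique)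
      (fun _ => not_step_inr) hn).2 fun _ => not_step_inr)).2
  · rintro rfl
    exact ⟨_, h⟩

end Proc

/-! ### Running a machine as a procedure -/

namespace Machine

variable {M : Machine}

/-- `c'` is the configuration in which a computation from `c` first halts or calls the oracle. -/
def Halts (M : Machine) (c c' : M.Cfg) : Prop :=
  (∃ n, Iter M.WorkStep c n c') ∧ ∀ d, ¬ M.WorkStep c' d

theorem run_of_iter {A : Lang} {c c' c'' : M.Cfg} {n t m : ℕ} (h : Iter M.WorkStep c n c')
    (h' : M.Run A c' t m c'') : M.Run A c (n + t) m c'' := by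
  induction h with
  | refl => simpa using h'
  | head h _ ih =>
    rw [Nat.add_right_comm]
    exact .work h (ih h')

theorem run_of_iter' {A : Lang} {c c' : M.Cfg} {n : ℕ} (h : Iter M.WorkStep c n c') :
    M.Run A c n 0 c' := run_of_iter h (.refl c')

theorem iter_of_run {A : Lang} {c c' : M.Cfg} {t : ℕ} (h : M.Run A c t 0 c') :
    Iter M.WorkStep c t c' := by
  generalize hm : 0 = m at h
  induction h with
  | refl => exact .refl _
  | work h _ ih => exact .head h (ih hm)
  | query => cases hm

theorem not_workStep {c d : M.Cfg} (h : M.kind c.state ≠ .work) : ¬ M.WorkStep c d :=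
  fun h' => h h'.1

theorem workStep_unique (hM : M.Deterministic) {a b c : M.Cfg} (hb : M.WorkStep a b)
    (hc : M.WorkStep a c) : b = c := by
  obtain ⟨-, x, hx, hx'⟩ := hb
  obtain ⟨-, y, hy, hy'⟩ := hc
  obtain ⟨h1, h2⟩ := Prod.ext_iff.1 (hM _ _ hx hy)
  dsimp only at h1 h2
  subst h2
  obtain ⟨q, T⟩ := b
  obtain ⟨q', T'⟩ := c
  obtain rfl : q = q' := h1
  obtain rfl : T = T' := funext fun k => (hx' k).trans (hy' k).symm
  rfl

theorem Halts.unique (hM : M.Deterministic) {a b c : M.Cfg} (hb : M.Halts a b)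
    (hc : M.Halts a c) : b = c := by
  obtain ⟨⟨n, hn⟩, hb⟩ := hb
  obtain ⟨⟨m, hm⟩, hc⟩ := hc
  exact (hm.unique (r := M.WorkStep) (fun _ _ _ => workStep_unique hM) hc hn).2 hb

/-- The procedure that runs the machine `M` from the state `q₀`, its tape `k` being the tape `κ k`
of the procedure, until it halts or calls the oracle. It is left through the state reached. -/
noncomputable def run {K : Type} (M : Machine) (κ : M.K → K) (q₀ : M.Q) : Proc K M.Q where
  Q := M.Q
  finQ := M.finQ
  start := q₀
  δ q s := {p | (M.kind q = .work ∧
      ∃ p' ∈ M.δ q (s ∘ κ), p = (inl p'.1, Function.extend κ p'.2 (idle s))) ∨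
    -- The exit is open exactly when `M` has no work step: it halts, is stuck, or is about to query.
    -- Leaving takes one idle step, the source of the `+ 1` in time bounds.
    p = (inr q, idle s) ∧ ¬ (M.kind q = .work ∧ (M.δ q (s ∘ κ)).Nonempty)}

section run

variable {K : Type} {κ : M.K → K}

/-- The configuration of the procedure that corresponds to a configuration of the machine, if the
tapes not used by the machine are as in `T`. -/
noncomputable def lift (κ : M.K → K) (T : Tapes K) (c : M.Cfg) : (M.Q ⊕ M.Q) × Tapes K :=
  (inl c.state, Function.extend κ c.tape T)

theorem act_extend (hκ : κ.Injective) (S : Tapes M.K) (T : Tapes K)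
    (a : M.K → Option Bool × Option Dir) :
    Tapes.act (Function.extend κ S T) (Function.extend κ a (idle (Tapes.scan
      (Function.extend κ S T)))) = Function.extend κ (S.act a) T := by
  funext k
  by_cases hk : ∃ j, κ j = k
  · obtain ⟨j, rfl⟩ := hk
    simp [Tapes.act, hκ.extend_apply]
  · simp [Tapes.act, Tapes.scan, idle, Function.extend_apply' _ _ _ hk]

theorem scan_extend (hκ : κ.Injective) (S : Tapes M.K) (T : Tapes K) :
    Tapes.scan (Function.extend κ S T) ∘ κ = S.scan := by
  funext k
  simp [Tapes.scan, hκ.extend_apply]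

theorem workStep_iff {c : M.Cfg} : (∃ d, M.WorkStep c d) ↔
    M.kind c.state = .work ∧ (M.δ c.state (Tapes.scan c.tape)).Nonempty := by
  constructor
  · rintro ⟨d, h, a, h', -⟩
    exact ⟨h, _, h'⟩
  · rintro ⟨h, ⟨q, a⟩, h'⟩
    exact ⟨⟨q, Tapes.act c.tape a⟩, h, a, h', fun _ => rfl⟩

theorem run_step (hκ : κ.Injective) {q₀ : M.Q} {T : Tapes K} {c : M.Cfg}
    {d : (M.Q ⊕ M.Q) × Tapes K} : (M.run κ q₀).Step (lift κ T c) d ↔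
      (∃ c', d = lift κ T c' ∧ M.WorkStep c c') ∨
        d = (inr c.state, Function.extend κ c.tape T) ∧ ∀ c', ¬ M.WorkStep c c' := by
  refine Proc.step_inl.trans ⟨?_, ?_⟩
  · rintro ⟨a, ⟨hk, ⟨q, a'⟩, h1, h2⟩ | ⟨h1, h2⟩, h3⟩
    · obtain ⟨h4, h5⟩ := Prod.ext_iff.1 h2
      obtain rfl : a = _ := h5
      rw [scan_extend hκ] at h1
      exact .inl ⟨⟨q, Tapes.act c.tape a'⟩, Prod.ext h4 (h3.trans (act_extend hκ _ _ _)), hk, a', h1,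
        fun _ => rfl⟩
    · obtain ⟨h4, h5⟩ := Prod.ext_iff.1 h1
      obtain rfl : a = _ := h5
      rw [scan_extend hκ] at h2
      exact .inr ⟨Prod.ext h4 (h3.trans (Tapes.act_idle _)),
        fun c' h => h2 (workStep_iff.1 ⟨c', h⟩)⟩
  · rintro (⟨c', rfl, h1, a, h2, h3⟩ | ⟨rfl, h⟩)
    · refine ⟨_, .inl ⟨h1, (c'.state, a), ?_, rfl⟩, ?_⟩
      · rwa [scan_extend hκ]
      · refine Eq.trans ?_ (act_extend hκ _ _ _).symm
        rw [← show c'.tape = Tapes.act c.tape a from funext h3]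
        rfl
    · refine ⟨_, .inr ⟨rfl, ?_⟩, (Tapes.act_idle _).symm⟩
      rw [scan_extend hκ]
      exact fun h' => (workStep_iff.2 h').elim h

theorem run_iter (hκ : κ.Injective) {q₀ : M.Q} {T : Tapes K} {c : M.Cfg}
    {n : ℕ} {d : (M.Q ⊕ M.Q) × Tapes K} (h : Iter (M.run κ q₀).Step (lift κ T c) n d) :
    (∃ c', d = lift κ T c' ∧ Iter M.WorkStep c n c') ∨
      ∃ c' m, n = m + 1 ∧ Iter M.WorkStep c m c' ∧ (∀ c'', ¬ M.WorkStep c' c'') ∧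
        d = (inr c'.state, Function.extend κ c'.tape T) := by
  generalize hx : lift κ T c = x at h
  induction h generalizing c with
  | refl => exact .inl ⟨c, hx.symm, .refl c⟩
  | head hr h' ih =>
    subst hx
    obtain ⟨c', rfl, hc⟩ | ⟨rfl, hc⟩ := (run_step hκ).1 hr
    · obtain ⟨c'', h1, h2⟩ | ⟨c'', m, rfl, h2, h3⟩ := ih rfl
      · exact .inl ⟨c'', h1, .head hc h2⟩
      · exact .inr ⟨c'', m + 1, rfl, .head hc h2, h3⟩
    · cases h' with
      | refl => exact .inr ⟨c, 0, rfl, .refl c, hc, rfl⟩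
      | head h' _ => exact absurd h' Proc.not_step_inr

theorem lift_start {q₀ : M.Q} {S : Tapes M.K} {T : Tapes K} (hS : ∀ k, T (κ k) = S k) :
    lift κ T ⟨q₀, S⟩ = (inl q₀, T) := by
  refine Prod.ext rfl (funext fun k => ?_)
  obtain rfl : S = T ∘ κ := funext fun k => (hS k).symm
  by_cases hk : ∃ j, κ j = k
  · obtain ⟨j, rfl⟩ := hk
    simp only [lift, Function.extend]
    split_ifs with h
    · exact congrArg T h.choose_spec
    · rfl
  · simp [lift, Function.extend_apply' _ _ _ hk]

theorem exec_run (hκ : κ.Injective) {q₀ q : M.Q} {S : Tapes M.K} {T T' : Tapes K}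
    (hS : ∀ k, T (κ k) = S k) : (M.run κ q₀).Exec T q T' ↔
      ∃ c, M.Halts ⟨q₀, S⟩ c ∧ q = c.state ∧ T' = Function.extend κ c.tape T := by
  constructor
  · rintro ⟨n, h⟩
    change Iter _ (inl q₀, T) _ _ at h
    rw [← lift_start hS] at h
    obtain ⟨c', h1, h2⟩ | ⟨c', m, rfl, h2, h3, h4⟩ := run_iter hκ h
    · cases (Prod.ext_iff.1 h1).1
    · cases h4
      exact ⟨c', ⟨⟨m, h2⟩, h3⟩, rfl, rfl⟩
  · rintro ⟨c, ⟨⟨n, h⟩, hc⟩, rfl, rfl⟩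
    have h1 := Iter.map (lift κ T) (fun a b hab => (run_step hκ (q₀ := q₀)).2 (.inl ⟨_, rfl, hab⟩)) h
    rw [lift_start hS] at h1
    exact ⟨n + 1, h1.trans (.head ((run_step hκ).2 (.inr ⟨rfl, hc⟩)) (.refl _))⟩

theorem timeLE_run (hκ : κ.Injective) {q₀ : M.Q} {S : Tapes M.K} {T : Tapes K}
    (hS : ∀ k, T (κ k) = S k) {N : ℕ} (h : ∀ n c, Iter M.WorkStep ⟨q₀, S⟩ n c → n ≤ N) :
    (M.run κ q₀).TimeLE T (N + 1) := by
  intro n c hn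
  change Iter _ (inl q₀, T) _ _ at hn
  rw [← lift_start hS] at hn
  obtain ⟨c', h1, h2⟩ | ⟨c', m, rfl, h2, -⟩ := run_iter hκ hn
  · exact (h _ _ h2).trans (Nat.le_succ _)
  · exact Nat.succ_le_succ (h _ _ h2)

end run

theorem acceptsAt_iff_of_oracleFree (hM : M.OracleFree) {A : Lang} {x : Word} {c : M.Cfg} :
    M.AcceptsAt A x c ↔ M.Halts (M.init x) c ∧ M.kind c.state = .accept := by
  constructor
  · rintro ⟨h, t, m, h'⟩
    refine ⟨⟨⟨t, ?_⟩, fun d => not_workStep (by simp [h])⟩, h⟩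
    clear h
    generalize M.init x = c₀ at h'
    induction h' with
    | refl => exact .refl _
    | work h _ ih => exact .head h ih
    | query h _ _ => exact absurd h.1 (hM _)
  · rintro ⟨⟨⟨n, h⟩, -⟩, h'⟩
    exact ⟨h', n, 0, run_of_iter' h⟩

theorem fits_of_iter {c c' : M.Cfg} {n N : ℕ} (h : Iter M.WorkStep c n c') {k : M.K}
    (hc : Fits (c.tape k) N) : Fits (c'.tape k) (N + 2 * n) := by
  induction h generalizing N with
  | refl => exact hc
  | head h _ ih =>
    obtain ⟨-, a, -, h⟩ := h
    have := ih (by rw [h k]; exact hc.act (a k))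
    exact this.mono (by omega)

end Machine

attribute [instance] Machine.finK Machine.finQ

theorem polynomial_eval_mono (p : Polynomial ℕ) : Monotone fun n => p.eval n := by
  intro m n h
  simp only [Polynomial.eval_eq_sum]
  exact Finset.sum_le_sum fun i _ => Nat.mul_le_mul_left _ (Nat.pow_le_pow_left h i)

namespace Machine

variable {K E : Type} {M : Machine}

theorem iter_le_of_polyTime {p : Polynomial ℕ}
    (hp : ∀ (A : Lang) (x : Word) (t m : ℕ) (c : M.Cfg),
      M.Run A (M.init x) t m c → t ≤ p.eval x.length)
    {x : Word} {n : ℕ} {c : M.Cfg} (h : Iter M.WorkStep (M.init x) n c) : n ≤ p.eval x.length :=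
  hp ∅ x n 0 c (run_of_iter' h)

open Classical in
/-- Run the machine `M`, and continue with `R` if it accepts. -/
noncomputable def runThen (M : Machine) (κ : M.K → K) (R : Proc K E) : Proc K E :=
  (M.run κ M.start).seq fun q => if M.kind q = .accept then R else .fail

theorem exec_runThen (hM : M.OracleFree) {κ : M.K → K} (hκ : κ.Injective) {R : Proc K E}
    {T T' : Tapes K} {x : Word} (hT : ∀ k, T (κ k) = initTapes M.input x k) {e : E} :
    (M.runThen κ R).Exec T e T' ↔
      ∃ c, M.AcceptsAt ∅ x c ∧ R.Exec (Function.extend κ c.tape T) e T' := by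
  rw [runThen, Proc.exec_seq]
  simp only [exec_run hκ hT, acceptsAt_iff_of_oracleFree hM]
  constructor
  · rintro ⟨q, S, ⟨c, hc, rfl, rfl⟩, h⟩
    split_ifs at h with hq
    · exact ⟨c, ⟨hc, hq⟩, h⟩
    · exact absurd h Proc.exec_fail
  · rintro ⟨c, ⟨hc, hq⟩, h⟩
    exact ⟨_, _, ⟨c, hc, rfl, rfl⟩, by rwa [if_pos hq]⟩

theorem timeLE_runThen (hM : M.OracleFree) {κ : M.K → K} (hκ : κ.Injective) {R : Proc K E}
    {T : Tapes K} {x : Word} (hT : ∀ k, T (κ k) = initTapes M.input x k) {N n : ℕ}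
    (hN : ∀ m c, Iter M.WorkStep (M.init x) m c → m ≤ N)
    (hR : ∀ c, M.AcceptsAt ∅ x c → R.TimeLE (Function.extend κ c.tape T) n) :
    (M.runThen κ R).TimeLE T (N + 1 + n) := by
  refine Proc.timeLE_seq (timeLE_run hκ hT hN) fun q S h => ?_
  obtain ⟨c, hc, rfl, rfl⟩ := (exec_run hκ hT).1 h
  split_ifs with hq
  · exact hR c ((acceptsAt_iff_of_oracleFree hM).2 ⟨hc, hq⟩)
  · exact Proc.timeLE_fail _ _

end Machine

/-! ### Complements of reducible languages -/

/-- Negating the first two bits of the output of a function in `NPSVt`. -/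
theorem negate_mem_NPSVt {a b : Word → Bool} {y : Word → Word}
    (hf : (fun x => a x :: b x :: y x) ∈ NPSVt) : (fun x => (!a x) :: (!b x) :: y x) ∈ NPSVt := by
  classical
  obtain ⟨N, hN, ⟨p, hp⟩, h⟩ := hf
  -- The second negation moves back to the left, so the output word again begins at the head.
  let R : Proc N.K Unit :=
    (Proc.onTape N.output fun s => ((), (s.map not, some Dir.right))).seq fun _ =>
      Proc.onTape N.output fun s => ((), (s.map not, some Dir.left))
  let P := N.runThen id R
  have hT : ∀ x k, initTapes N.input x (id k) = initTapes N.input x k := fun _ _ => rfl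
  have hid : ∀ S T : Tapes N.K, Function.extend id S T = S :=
    fun S T => funext fun k => Function.injective_id.extend_apply S T k
  have hR : ∀ x (c : N.Cfg), N.AcceptsAt ∅ x c → ∃ T', (∀ u S, R.Exec c.tape u S ↔ S = T') ∧
      Holds (T' N.output) ((!a x) :: (!b x) :: y x) := by
    intro x c hc
    let T₁ := Function.update c.tape N.output
      (act (c.tape N.output) ((c.tape N.output).head.map not, some Dir.right))
    refine ⟨Function.update T₁ N.output
      (act (T₁ N.output) ((T₁ N.output).head.map not, some Dir.left)), fun u S => ?_, ?_⟩
    · rw [Proc.exec_seq]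
      simp only [Proc.exec_onTape]
      constructor
      · rintro ⟨_, _, ⟨-, rfl⟩, -, h⟩
        exact h
      · intro h
        exact ⟨(), _, ⟨trivial, rfl⟩, trivial, h⟩
    · have hh := (h x).2 c hc
      obtain ⟨h1, h2⟩ := holds_cons.1 hh
      obtain ⟨h2, h3⟩ := holds_cons.1 h2
      simp only [T₁, Function.update_self, act, h1, Option.map_some]
      rw [holds_cons, holds_cons]
      generalize c.tape N.output = T at h1 h2 h3
      have h4 : ((T.write (some !a x)).move Dir.right).head = some (b x) := h2
      rw [h4, Tape.move_left_right]
      refine ⟨?_, rfl, fun i hi => ?_⟩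
      swap
      · have e1 : (i : ℤ) + 1 ≠ 0 := by omega
        have e2 : (i : ℤ) + 1 + 1 ≠ 0 := by omega
        simpa [e1, e2] using h3 i hi
      cases T
      simp [Tape.move, Tape.write]
  refine ⟨P.toMachine N.input N.output, Proc.toMachine_oracleFree,
    Proc.toMachine_polyTime (p + 3) fun x => ?_, fun x => ?_⟩
  · have := Machine.timeLE_runThen hN (κ := id) Function.injective_id (R := R) (n := 1 + 1) (hT x)
      (fun m c => Machine.iter_le_of_polyTime hp)
      (fun c _ => Proc.timeLE_seq (Proc.timeLE_onTape _) fun _ _ _ => Proc.timeLE_onTape _)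
    refine this.mono ?_
    simp only [Polynomial.eval_add, Polynomial.eval_ofNat]
    omega
  · have key : ∀ S, P.Exec (initTapes N.input x) () S ↔
        ∃ c, N.AcceptsAt ∅ x c ∧ R.Exec c.tape () S := by
      intro S
      rw [Machine.exec_runThen hN Function.injective_id (hT x)]
      simp only [hid]
    constructor
    · obtain ⟨c, hc, -⟩ := (h x).1
      obtain ⟨T', h1, h2⟩ := hR x c hc
      exact ⟨⟨inr (), T'⟩, Proc.toMachine_acceptsAt.2 ⟨rfl, (key _).2 ⟨c, hc, (h1 _ _).2 rfl⟩⟩, h2⟩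
    · intro d hd
      obtain ⟨c, hc, h'⟩ := (key _).1 (Proc.toMachine_acceptsAt.1 hd).2
      obtain ⟨T', h1, h2⟩ := hR x c hc
      obtain h3 : d.tape = T' := (h1 _ _).1 h'
      rw [h3]
      exact h2

/-- Entry 0 of the table is the value at false and entry 1 the value at true; a single word is its
own last component, hence not delimited. -/
theorem tableCode_append_tupleCode (α : (Fin 1 → Bool) → Bool) (y : Fin 1 → Word) :
    tableCode α ++ tupleCode (List.ofFn y) =
      α (fun _ => false) :: α (fun _ => true) :: y 0 := by
  simp [tableCode, tupleCode, List.ofFn_succ]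

theorem snttReducible_one_iff {L B : Lang} : SNttReducible 1 L B ↔
    ∃ (a : Word → Bool → Bool) (y : Word → Word),
      (fun x => a x false :: a x true :: y x) ∈ NPSVt ∧ ∀ x, x ∈ L ↔ a x (chi B (y x)) = true := by
  constructor
  · rintro ⟨y, α, h, h'⟩
    refine ⟨fun x b => α x fun _ => b, fun x => y x 0, ?_, fun x => ?_⟩
    · simpa only [tableCode_append_tupleCode] using h
    · rw [h' x, show (fun i => chi B (y x i)) = fun _ => chi B (y x 0) from
        funext fun i => by rw [Subsingleton.elim i 0]]
  · rintro ⟨a, y, h, h'⟩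
    refine ⟨fun x _ => y x, fun x v => a x (v 0), ?_, h'⟩
    simpa only [tableCode_append_tupleCode] using h

theorem compl_mem_RSNtt {C : LangClass} {L : Lang} (hL : L ∈ RSNtt 1 C) : Lᶜ ∈ RSNtt 1 C := by
  obtain ⟨B, hB, h⟩ := hL
  refine ⟨B, hB, ?_⟩
  obtain ⟨a, y, h1, h2⟩ := snttReducible_one_iff.1 h
  exact snttReducible_one_iff.2 ⟨fun x b => !a x b, y, negate_mem_NPSVt h1, fun x => by
    simp [h2]⟩

/-! ### Reducible languages as differences -/

/-- If a function in `NPSVt` outputs two bits and a word, then it is in NP to decide on the bits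
whether to accept, to reject, or to ask whether the word is in a given NP language. -/
theorem setOf_mem_NP {a b : Word → Bool} {y : Word → Word}
    (hf : (fun x => a x :: b x :: y x) ∈ NPSVt) {B : Lang} (hB : B ∈ NP)
    (g : Option Bool → Option Bool → Option Bool) :
    {x | g (a x) (b x) = some true ∨ g (a x) (b x) = none ∧ y x ∈ B} ∈ NP := by
  classical
  obtain ⟨N, hN, ⟨p, hp⟩, h⟩ := hf
  obtain ⟨N', hN', ⟨p', hp'⟩, rfl⟩ := hB
  let o : N.K ⊕ N'.K := inl N.output
  let j : N.K ⊕ N'.K := inr N'.input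
  let ask : Proc (N.K ⊕ N'.K) Unit := (Proc.copy o j {j}).seq fun _ => N'.runThen inr (.ret ())
  let branch : Option Bool → Proc (N.K ⊕ N'.K) Unit := fun r =>
    match r with
    | some true => .ret ()
    | some false => .fail
    | none => ask
  -- The exit is the scanned symbol, possibly blank; this is why `g` takes arguments in `Option
  -- Bool`.
  let read : Proc (N.K ⊕ N'.K) (Option Bool) := .onTape o fun s => (s, (s, some Dir.right))
  let R : Proc (N.K ⊕ N'.K) Unit := read.seq fun s => read.seq fun s' => branch (g s s')
  let P : Proc (N.K ⊕ N'.K) Unit := N.runThen inl R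
  let i : N.K ⊕ N'.K := inl N.input
  have hT : ∀ x k, initTapes i x (inl k) = initTapes N.input x k := by
    intro x k
    simp [initTapes, i]
  have hT' : ∀ x k, initTapes i x (inr k) = Tape.mk₁ [] := by
    intro x k
    simp [initTapes, i]
  have hread : ∀ (T T' : Tapes (N.K ⊕ N'.K)) e, read.Exec T e T' ↔
      e = (T o).head ∧ T' = Function.update T o ((T o).move Dir.right) := by
    intro T T' e
    rw [Proc.exec_onTape]
    simp [act]
  -- the situation after reading the two bits
  have hread2 : ∀ x (c : N.Cfg), N.AcceptsAt ∅ x c → ∃ S : Tapes (N.K ⊕ N'.K), Holds (S o) (y x) ∧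
      (∀ k, S (inr k) = Tape.mk₁ []) ∧ (∀ T', R.Exec (Function.extend inl c.tape (initTapes i x)) () T' ↔
        (branch (g (a x) (b x))).Exec S () T') ∧
      ∀ n, (branch (g (a x) (b x))).TimeLE S n →
        R.TimeLE (Function.extend inl c.tape (initTapes i x)) (1 + (1 + n)) := by
    intro x c hc
    obtain ⟨h1, h2⟩ := holds_cons.1 ((h x).2 c hc)
    obtain ⟨h2, h3⟩ := holds_cons.1 h2
    set T₀ : Tapes (N.K ⊕ N'.K) := Function.extend inl c.tape (initTapes i x) with hT₀
    have hT₀o : T₀ o = c.tape N.output := inl_injective.extend_apply _ _ _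
    set T₁ := Function.update T₀ o ((T₀ o).move Dir.right) with hT₁
    have hT₁o : T₁ o = (c.tape N.output).move Dir.right := by
      rw [hT₁, Function.update_self, hT₀o]
    set T₂ := Function.update T₁ o ((T₁ o).move Dir.right) with hT₂
    have e1 : ∀ T' e, read.Exec T₀ e T' ↔ e = some (a x) ∧ T' = T₁ := by
      intro T' e
      rw [hread, hT₀o, h1, ← hT₀o]
    have e2 : ∀ T' e, read.Exec T₁ e T' ↔ e = some (b x) ∧ T' = T₂ := by
      intro T' e
      rw [hread, hT₁o, h2, ← hT₁o]
    refine ⟨T₂, ?_, fun k => ?_, fun T' => ?_, fun n hn => ?_⟩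
    · rwa [hT₂, Function.update_self, hT₁o]
    · rw [hT₂, Function.update_of_ne (by simp [o]), hT₁, Function.update_of_ne (by simp [o]), hT₀,
        Function.extend_apply' _ _ _ (by simp), hT']
    · rw [Proc.exec_seq]
      simp only [Proc.exec_seq, e1]
      constructor
      · rintro ⟨_, _, ⟨rfl, rfl⟩, _, _, h4, h5⟩
        obtain ⟨rfl, rfl⟩ := (e2 _ _).1 h4
        exact h5
      · intro h4
        exact ⟨_, _, ⟨rfl, rfl⟩, _, _, (e2 _ _).2 ⟨rfl, rfl⟩, h4⟩
    · refine Proc.timeLE_seq (Proc.timeLE_onTape _) fun e S he => ?_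
      obtain ⟨rfl, rfl⟩ := (e1 _ _).1 he
      refine Proc.timeLE_seq (Proc.timeLE_onTape _) fun e S he => ?_
      obtain ⟨rfl, rfl⟩ := (e2 _ _).1 he
      exact hn
  have hask : ∀ (S : Tapes (N.K ⊕ N'.K)) (w : Word), Holds (S o) w → (∀ k, S (inr k) = Tape.mk₁ []) →
      ((∃ T', ask.Exec S () T') ↔ w ∈ N'.language ∅) ∧
      ask.TimeLE S (2 * w.length + 2 + (p'.eval w.length + 1 + 1)) := by
    intro S w hS hS'
    have hD : ∀ k ∈ ({j} : Set (N.K ⊕ N'.K)), S k = Tape.mk₁ [] := by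
      rintro k rfl
      exact hS' _
    obtain ⟨T₁, h1, h2, h3⟩ := Proc.exec_copy (i := o) (j := j) (Set.mem_singleton j) hS hD
    -- The tapes of `N'` are blank until the copy is made, so afterwards they are exactly its
    -- initial tapes on `w`.
    have hT₁ : ∀ k, T₁ (inr k) = initTapes N'.input w k := by
      intro k
      by_cases hk : k = N'.input
      · rw [h2 _ (by rw [hk]; rfl), initTapes, if_pos hk]
      · rw [h3 _ (by simpa [j] using hk) (by simp [o]), hS', initTapes, if_neg hk]
    constructor
    · simp only [ask, Proc.exec_seq, h1]
      constructor
      · rintro ⟨T', -, S', rfl, h4⟩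
        obtain ⟨c, hc, -⟩ := (Machine.exec_runThen hN' inr_injective hT₁).1 h4
        exact ⟨c, hc⟩
      · rintro ⟨c, hc⟩
        exact ⟨_, (), T₁, rfl, (Machine.exec_runThen hN' inr_injective hT₁).2
          ⟨c, hc, Proc.exec_ret.2 ⟨rfl, rfl⟩⟩⟩
    · refine Proc.timeLE_seq (Proc.timeLE_copy (Set.mem_singleton j) hS hD) fun u S' h4 => ?_
      obtain rfl := (h1 _ _).1 h4
      exact Machine.timeLE_runThen hN' inr_injective hT₁
        (fun m c => Machine.iter_le_of_polyTime hp') fun c _ => Proc.timeLE_ret _ _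
  -- Each step of `N` enlarges a tape by at most 2 cells, so its output has length at most `|x| + 2
  -- p(|x|)`.
  let r : Polynomial ℕ := .X + 2 * p
  have hlen : ∀ x, (y x).length ≤ r.eval x.length := by
    intro x
    obtain ⟨c, hc, h'⟩ := (h x).1
    obtain ⟨⟨⟨n, hn⟩, -⟩, -⟩ := (Machine.acceptsAt_iff_of_oracleFree hN).1 hc
    have h1 := (Machine.fits_of_iter hn (k := N.output) (fits_initTapes _ x _)).length_le h'
    have h2 := Machine.iter_le_of_polyTime hp hn
    simp only [r, List.length_cons, Polynomial.eval_add, Polynomial.eval_X, Polynomial.eval_mul,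
      Polynomial.eval_ofNat] at h1 ⊢
    omega
  refine ⟨P.toMachine i i, Proc.toMachine_oracleFree,
    Proc.toMachine_polyTime (p + 2 * r + p'.comp r + 7) fun x => ?_, ?_⟩
  · refine (Machine.timeLE_runThen hN (κ := inl) inl_injective (R := R)
      (n := 1 + (1 + (2 * r.eval x.length + 2 + (p'.eval (r.eval x.length) + 1 + 1)))) (hT x)
      (fun m c => Machine.iter_le_of_polyTime hp) fun c hc => ?_).mono ?_
    · obtain ⟨S, h1, h2, -, h3⟩ := hread2 x c hc
      refine h3 _ ?_
      rcases g (a x) (b x) with _ | _ | _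
      · refine ((hask S _ h1 h2).2).mono ?_
        have h4 := polynomial_eval_mono p' (hlen x)
        have h5 := hlen x
        dsimp only at h4
        omega
      · exact Proc.timeLE_fail _ _
      · exact (Proc.timeLE_ret _ _).mono (by omega)
    · simp only [Polynomial.eval_add, Polynomial.eval_mul, Polynomial.eval_ofNat,
        Polynomial.eval_comp]
      omega
  · have key : ∀ x, x ∈ (P.toMachine i i).language ∅ ↔ ∃ T', P.Exec (initTapes i x) () T' := by
      intro x
      constructor
      · rintro ⟨c, hc⟩
        exact ⟨_, (Proc.toMachine_acceptsAt.1 hc).2⟩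
      · rintro ⟨T', h'⟩
        exact ⟨⟨inr (), T'⟩, Proc.toMachine_acceptsAt.2 ⟨rfl, h'⟩⟩
    have key2 : ∀ (x : Word) (S : Tapes (N.K ⊕ N'.K)), Holds (S o) (y x) → (∀ k, S (inr k) = Tape.mk₁ []) →
        ((∃ T', (branch (g (a x) (b x))).Exec S () T') ↔
          g (a x) (b x) = some true ∨ g (a x) (b x) = none ∧ y x ∈ N'.language ∅) := by
      intro x S h1 h2
      rcases g (a x) (b x) with _ | _ | _
      · simpa [branch] using (hask S _ h1 h2).1
      · simp [branch, Proc.exec_fail]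
      · simp [branch, Proc.exec_ret]
    ext x
    rw [key]
    simp only [P, Machine.exec_runThen hN inl_injective (hT x), Set.mem_ofPred_eq]
    -- Totality of the function provides an accepting path of `N`. Conversely, by single-valuedness
    -- every accepting path shows the same bits and word, so the verdict does not depend on the
    -- path.
    constructor
    · intro hx
      obtain ⟨c, hc, -⟩ := (h x).1
      obtain ⟨S, h1, h2, h3, -⟩ := hread2 x c hc
      obtain ⟨T', h4⟩ := (key2 x S h1 h2).2 hx
      exact ⟨T', c, hc, (h3 _).2 h4⟩
    · rintro ⟨T', c, hc, h4⟩
      obtain ⟨S, h1, h2, h3, -⟩ := hread2 x c hc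
      exact (key2 x S h1 h2).1 ⟨T', (h3 _).1 h4⟩

theorem RSNtt_one_subset_DP : RSNtt 1 NP ⊆ DP := by
  rintro L ⟨B, hB, h⟩
  obtain ⟨a, y, h1, h2⟩ := snttReducible_one_iff.1 h
  -- For tables written as (value at no, value at yes): the first set is everything for (1,·), `y x
  -- ∈ B` for (0,1), and empty for (0,0). The second removes `y x ∈ B` for (1,0) alone.
  refine ⟨_, setOf_mem_NP h1 hB fun s t => if s = some true then some true else
    if t = some true then none else some false, _, setOf_mem_NP h1 hB fun s t =>
    if s = some true ∧ t = some false then none else some false, ?_⟩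
  ext x
  rw [h2 x]
  by_cases hx : y x ∈ B
  · cases h3 : a x false <;> cases h4 : a x true <;> simp [chi, hx, h3, h4]
  · cases h3 : a x false <;> cases h4 : a x true <;> simp [chi, hx, h3, h4]

/-! ### One query to an oracle -/

namespace Machine

variable {K : Type} {M : Machine}

theorem extend_extend {κ : M.K → K} (S S' : Tapes M.K) (T : Tapes K) :
    Function.extend κ S' (Function.extend κ S T) = Function.extend κ S' T := by
  classical
  funext k
  simp only [Function.extend_def]
  split_ifs <;> rfl

open Classical in
/-- With `b` as the answer to its first query, `M` halts or makes another query on input `x` in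
the configuration `c`. -/
def HaltsWith (M : Machine) (x : Word) (b : Bool) (c : M.Cfg) : Prop :=
  ∃ c₁, M.Halts (M.init x) c₁ ∧
    if M.kind c₁.state = .query then M.Halts ⟨M.answer c₁.state b, c₁.tape⟩ c else c = c₁

theorem HaltsWith.unique (hM : M.Deterministic) {x : Word} {b : Bool} {c d : M.Cfg}
    (hc : M.HaltsWith x b c) (hd : M.HaltsWith x b d) : c = d := by
  obtain ⟨c₁, h1, h2⟩ := hc
  obtain ⟨d₁, h3, h4⟩ := hd
  obtain rfl := h1.unique hM h3
  split_ifs at h2 h4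
  · exact h2.unique hM h4
  · rw [h2, h4]

theorem iter_answer_le {p : Polynomial ℕ}
    (hp : ∀ (A : Lang) (x : Word) (t m : ℕ) (c : M.Cfg),
      M.Run A (M.init x) t m c → t ≤ p.eval x.length)
    {x : Word} {c₁ : M.Cfg} (h : M.Halts (M.init x) c₁) (hq : M.kind c₁.state = .query) (b : Bool)
    {n : ℕ} {c : M.Cfg} (hn : Iter M.WorkStep ⟨M.answer c₁.state b, c₁.tape⟩ n c) :
    n ≤ p.eval x.length := by
  obtain ⟨⟨k, hk⟩, -⟩ := h
  obtain ⟨w, hw⟩ := holds_exists (c₁.tape M.queryTape)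
  -- The simulated answer may be wrong for the actual oracle, but it is right for the full or the
  -- empty oracle, and the time bound holds for every oracle.
  have hstep : M.QueryStep {_v | b = true} c₁ ⟨M.answer c₁.state b, c₁.tape⟩ :=
    ⟨hq, w, b, hw, Iff.rfl, rfl, rfl⟩
  have := hp _ x _ _ _ (run_of_iter hk (.query hstep (run_of_iter' hn)))
  omega

theorem exists_halts_init (hM : M.PolyTime) (x : Word) : ∃ c, M.Halts (M.init x) c := by
  obtain ⟨p, hp⟩ := hM
  obtain ⟨n, z, h, h'⟩ := Iter.exists_terminal (r := M.WorkStep) (a := M.init x)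
    fun n c => iter_le_of_polyTime hp
  exact ⟨z, ⟨n, h⟩, h'⟩

theorem exists_haltsWith (hM : M.PolyTime) (x : Word) (b : Bool) : ∃ c, M.HaltsWith x b c := by
  obtain ⟨c₁, h⟩ := exists_halts_init hM x
  obtain ⟨p, hp⟩ := hM
  by_cases hq : M.kind c₁.state = .query
  · obtain ⟨n, z, h1, h2⟩ := Iter.exists_terminal (r := M.WorkStep)
      (a := ⟨M.answer c₁.state b, c₁.tape⟩) fun n c => iter_answer_le hp h hq b
    exact ⟨z, c₁, h, by rw [if_pos hq]; exact ⟨⟨n, h1⟩, h2⟩⟩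
  · exact ⟨c₁, c₁, h, by rw [if_neg hq]⟩

/-- The structure of computations: either there is no query, or there is a first one. -/
theorem run_cases {A : Lang} {c c' : M.Cfg} {t m : ℕ} (h : M.Run A c t m c') :
    Iter M.WorkStep c t c' ∨ ∃ d d' n t' m', Iter M.WorkStep c n d ∧ M.QueryStep A d d' ∧
      M.Run A d' t' m' c' ∧ m = m' + 1 := by
  induction h with
  | refl => exact .inl (.refl _)
  | work h _ ih =>
    obtain h' | ⟨d, d', n, t', m', h1, h2⟩ := ih
    · exact .inl (.head h h')
    · exact .inr ⟨d, d', _, t', m', .head h h1, h2⟩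
  | query h h' _ => exact .inr ⟨_, _, _, _, _, .refl _, h, h', rfl⟩

/-- If `M` makes at most one query to `A`, it accepts if and only if it does so with the answer
to the query that `A` gives. -/
theorem mem_language_iff {A : Lang} (hM : M.Deterministic) {x w : Word}
    (hA : ∀ t m c, M.Run A (M.init x) t m c → m ≤ 1) {c₁ c : M.Cfg} (h₁ : M.Halts (M.init x) c₁)
    (hw : Holds (c₁.tape M.queryTape) w) (hc : M.HaltsWith x (chi A w) c) :
    x ∈ M.language A ↔ M.kind c.state = .accept := by
  obtain ⟨c₂, h₂, hc⟩ := hc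
  obtain rfl := h₂.unique hM h₁
  constructor
  · rintro ⟨d, hd, t, m, hr⟩
    have hd' : ∀ e, ¬ M.WorkStep d e := fun e => not_workStep (by simp [hd])
    obtain h | ⟨e, e', n, t', m', h1, h2, h3, rfl⟩ := run_cases hr
    · obtain rfl := h₂.unique hM ⟨⟨_, h⟩, hd'⟩
      rw [if_neg (by simp [hd])] at hc
      rwa [hc]
    · obtain rfl := h₂.unique hM ⟨⟨_, h1⟩, fun e => not_workStep (by simp [h2.1])⟩
      rw [if_pos h2.1] at hc
      obtain ⟨-, w', b, hw', hb, h4, h5⟩ := h2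
      obtain rfl := hw'.unique hw
      have hb' : b = chi A w' := by
        by_cases hwA : w' ∈ A <;> simp_all [chi]
      -- The one permitted query is already spent, so the rest of the run consists of work steps and
      -- must agree with the simulation.
      obtain rfl : m' = 0 := by
        have := hA _ _ _ hr
        omega
      have h6 : e' = ⟨M.answer c₂.state (chi A w'), c₂.tape⟩ := by
        cases e'
        simp_all
      rw [h6] at h3
      rw [hc.unique hM ⟨⟨_, iter_of_run h3⟩, hd'⟩]
      exact hd
  · intro h
    obtain ⟨⟨n, h1⟩, -⟩ := h₂
    split_ifs at hc with hq
    · obtain ⟨⟨k, hk⟩, -⟩ := hc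
      have hstep : M.QueryStep A c₂ ⟨M.answer c₂.state (chi A w), c₂.tape⟩ :=
        ⟨hq, w, chi A w, hw, by simp [chi], rfl, rfl⟩
      exact ⟨c, h, _, _, run_of_iter h1 (.query hstep (run_of_iter' hk))⟩
    · subst hc
      exact ⟨_, h, _, _, run_of_iter' h1⟩

open Classical in
/-- Run the machine `M`, with `b` as the answer to its first query, and determine whether it
accepts without a further query. -/
noncomputable def runWith (M : Machine) (κ : M.K → K) (b : Bool) : Proc K Bool :=
  (M.run κ M.start).seq fun q => if M.kind q = .query
    then (M.run κ (M.answer q b)).seq fun q' => .ret (decide (M.kind q' = .accept))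
    else .ret (decide (M.kind q = .accept))

open Classical in
theorem exec_runWith {κ : M.K → K} (hκ : κ.Injective) {b : Bool} {T T' : Tapes K} {x : Word}
    (hT : ∀ k, T (κ k) = initTapes M.input x k) {e : Bool} : (M.runWith κ b).Exec T e T' ↔
      ∃ c, M.HaltsWith x b c ∧ e = decide (M.kind c.state = .accept) ∧
        T' = Function.extend κ c.tape T := by
  have hext : ∀ (S : Tapes M.K) k, Function.extend κ S T (κ k) = S k :=
    fun S k => hκ.extend_apply _ _ _
  rw [runWith, Proc.exec_seq]
  simp only [exec_run hκ hT]
  constructor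
  · rintro ⟨q, S, ⟨c₁, h1, rfl, rfl⟩, h⟩
    split_ifs at h with hq
    · obtain ⟨q', S', h2, h3⟩ := Proc.exec_seq.1 h
      obtain ⟨c, h4, rfl, rfl⟩ := (exec_run hκ (hext _)).1 h2
      obtain ⟨rfl, rfl⟩ := Proc.exec_ret.1 h3
      exact ⟨c, ⟨c₁, h1, by rwa [if_pos hq]⟩, rfl, extend_extend _ _ _⟩
    · obtain ⟨rfl, rfl⟩ := Proc.exec_ret.1 h
      exact ⟨c₁, ⟨c₁, h1, by rw [if_neg hq]⟩, rfl, rfl⟩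
  · rintro ⟨c, ⟨c₁, h1, h2⟩, rfl, rfl⟩
    refine ⟨_, _, ⟨c₁, h1, rfl, rfl⟩, ?_⟩
    split_ifs at h2 ⊢ with hq
    · exact Proc.exec_seq.2 ⟨_, _, (exec_run hκ (hext _)).2 ⟨c, h2, rfl, rfl⟩,
        Proc.exec_ret.2 ⟨rfl, (extend_extend _ _ _).symm⟩⟩
    · subst h2
      exact Proc.exec_ret.2 ⟨rfl, rfl⟩

theorem timeLE_runWith {κ : M.K → K} (hκ : κ.Injective) {b : Bool} {T : Tapes K} {x : Word}
    (hT : ∀ k, T (κ k) = initTapes M.input x k) {p : Polynomial ℕ}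
    (hp : ∀ (A : Lang) (x : Word) (t m : ℕ) (c : M.Cfg),
      M.Run A (M.init x) t m c → t ≤ p.eval x.length) :
    (M.runWith κ b).TimeLE T (p.eval x.length + 1 + (p.eval x.length + 1 + 1)) := by
  refine Proc.timeLE_seq (timeLE_run hκ hT fun n c => iter_le_of_polyTime hp) fun q S h => ?_
  obtain ⟨c₁, h1, rfl, rfl⟩ := (exec_run hκ hT).1 h
  split_ifs with hq
  · exact Proc.timeLE_seq (timeLE_run hκ (fun k => hκ.extend_apply _ _ _)
      fun n c => iter_answer_le hp h1 hq b) fun _ _ _ => Proc.timeLE_ret _ _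
  · exact (Proc.timeLE_ret _ _).mono (by omega)

end Machine

namespace Proc

/-- Write two bits in front of the word on the tape `k`. -/
noncomputable def prefixTwo {K : Type} (k : K) (a b : Bool) : Proc K Unit :=
  (onTape k fun s => ((), (s, some Dir.left))).seq fun _ =>
    (onTape k fun _ => ((), (some b, some Dir.left))).seq fun _ =>
      onTape k fun _ => ((), (some a, none))

theorem exec_prefixTwo {K : Type} {k : K} {a b : Bool} {T : Tapes K} {w : Word}
    (hw : Holds (T k) w) : ∃ T', (∀ u S, (prefixTwo k a b).Exec T u S ↔ S = T') ∧
      Holds (T' k) (a :: b :: w) := by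
  classical
  let T₁ := Function.update T k ((T k).move Dir.left)
  let T₂ := Function.update T₁ k (((T₁ k).write (some b)).move Dir.left)
  refine ⟨Function.update T₂ k ((T₂ k).write (some a)), fun u S => ?_, ?_⟩
  · simp only [prefixTwo, exec_seq, exec_onTape]
    constructor
    · rintro ⟨_, _, ⟨-, rfl⟩, _, _, ⟨-, rfl⟩, -, h⟩
      simpa [act, T₁, T₂] using h
    · intro h
      refine ⟨(), _, ⟨trivial, rfl⟩, (), _, ⟨trivial, rfl⟩, trivial, ?_⟩
      simpa [act, T₁, T₂] using h
  · simp only [T₂, T₁, Function.update_self]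
    exact (hw.prepend b).prepend a

theorem timeLE_prefixTwo {K : Type} {k : K} {a b : Bool} (T : Tapes K) :
    (prefixTwo k a b).TimeLE T 3 :=
  timeLE_seq (n := 2) (timeLE_onTape _) fun _ _ _ => timeLE_seq (n := 1) (timeLE_onTape _)
    fun _ _ _ => timeLE_onTape _

end Proc

theorem POneQuery_subset_RSNtt : POneQuery NP ⊆ RSNtt 1 NP := by
  classical
  rintro L ⟨A, hA, M, hdet, hpoly, hone, rfl⟩
  refine ⟨A, hA, snttReducible_one_iff.2 ?_⟩
  choose c₁ hc₁ using Machine.exists_halts_init hpoly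
  choose c hc using Machine.exists_haltsWith hpoly
  -- If no query is made this is whatever the query tape holds at the end; it is harmless, since the
  -- two verdicts then coincide.
  choose y hy using fun x => holds_exists ((c₁ x).tape M.queryTape)
  let acc : Word → Bool → Bool := fun x b => decide (M.kind (c x b).state = .accept)
  refine ⟨acc, y, ?_, fun x => ?_⟩
  swap
  · rw [Machine.mem_language_iff hdet (hone x) (hc₁ x) (hy x) (hc x _)]
    simp [acc]
  obtain ⟨p, hp⟩ := hpoly
  -- Three disjoint sets of tapes for `M`, and `none` for the input. Each simulation spoils its
  -- tapes, so each gets its own copy of the input.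
  let κ : Fin 3 → M.K → Option (Fin 3 × M.K) := fun i k => some (i, k)
  have hκ : ∀ i, (κ i).Injective := fun i k k' h => by simpa [κ] using h
  have hne : ∀ {i i' : Fin 3}, i ≠ i' → ∀ (S : Tapes M.K) T k,
      Function.extend (κ i) S T (κ i' k) = T (κ i' k) := by
    intro i i' hi S T k
    refine Function.extend_apply' _ _ _ fun ⟨k', h⟩ => hi ?_
    simp only [κ, Option.some.injEq, Prod.mk.injEq] at h
    exact h.1
  let D : Set (Option (Fin 3 × M.K)) := {k | ∃ i, k = κ i M.input}
  let j := κ 0 M.input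
  have hj : j ∈ D := ⟨0, rfl⟩
  -- The third simulation stops at the first query with `y x` on this tape, so putting the two bits
  -- in front of it completes the output.
  let o := κ 2 M.queryTape
  let R₃ : Bool → Bool → Proc (Option (Fin 3 × M.K)) Unit := fun a b =>
    (M.run (κ 2) M.start).seq fun _ => .prefixTwo o a b
  let R₂ : Bool → Proc (Option (Fin 3 × M.K)) Unit := fun a =>
    (M.runWith (κ 1) true).seq fun b => R₃ a b
  let R₁ : Proc (Option (Fin 3 × M.K)) Unit := (M.runWith (κ 0) false).seq R₂
  let P : Proc (Option (Fin 3 × M.K)) Unit := (Proc.copy none j D).seq fun _ => R₁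
  have h₃ : ∀ x a b (T : Tapes (Option (Fin 3 × M.K))),
      (∀ k, T (κ 2 k) = initTapes M.input x k) →
      (∃ T', (∀ S, (R₃ a b).Exec T () S ↔ S = T') ∧ Holds (T' o) (a :: b :: y x)) ∧
      (R₃ a b).TimeLE T (p.eval x.length + 1 + 3) := by
    intro x a b T hT
    -- Determinism of `M` leaves only one possible result, as single-valuedness requires.
    have hex : ∀ q S, (M.run (κ 2) M.start).Exec T q S ↔
        q = (c₁ x).state ∧ S = Function.extend (κ 2) (c₁ x).tape T := by
      intro q S
      rw [Machine.exec_run (hκ 2) hT]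
      constructor
      · rintro ⟨d, hd, rfl, rfl⟩
        obtain rfl := (hc₁ x).unique hdet hd
        exact ⟨rfl, rfl⟩
      · rintro ⟨rfl, rfl⟩
        exact ⟨_, hc₁ x, rfl, rfl⟩
    constructor
    · obtain ⟨T', h1, h2⟩ := Proc.exec_prefixTwo (a := a) (b := b) (k := o) (w := y x)
        (T := Function.extend (κ 2) (c₁ x).tape T) (by rw [(hκ 2).extend_apply]; exact hy x)
      refine ⟨T', fun S => ?_, h2⟩
      simp only [R₃, Proc.exec_seq, hex]
      constructor
      · rintro ⟨_, _, ⟨rfl, rfl⟩, h⟩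
        exact (h1 _ _).1 h
      · intro h
        exact ⟨_, _, ⟨rfl, rfl⟩, (h1 _ _).2 h⟩
    · exact Proc.timeLE_seq (Machine.timeLE_run (hκ 2) hT
        fun n c => Machine.iter_le_of_polyTime hp) fun _ _ _ => Proc.timeLE_prefixTwo _
  have hwith : ∀ x b i (T : Tapes (Option (Fin 3 × M.K))),
      (∀ k, T (κ i k) = initTapes M.input x k) → ∀ e S, (M.runWith (κ i) b).Exec T e S ↔
        e = acc x b ∧ S = Function.extend (κ i) (c x b).tape T := by
    intro x b i T hT e S
    rw [Machine.exec_runWith (hκ i) hT]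
    constructor
    · rintro ⟨d, hd, h⟩
      obtain rfl := (hc x b).unique hdet hd
      exact h
    · rintro h
      exact ⟨_, hc x b, h⟩
  have h₀ : ∀ x, ∃ T, (∀ u S, (Proc.copy none j D).Exec (initTapes none x) u S ↔ S = T) ∧
      (∀ i k, T (κ i k) = initTapes M.input x k) ∧
      (Proc.copy none j D).TimeLE (initTapes none x) (2 * x.length + 2) := by
    intro x
    have h1 : Holds (initTapes (none : Option (Fin 3 × M.K)) x none) x := by
      simpa [initTapes] using holds_mk₁ x
    have h2 : ∀ k ∈ D, initTapes (none : Option (Fin 3 × M.K)) x k = Tape.mk₁ [] := by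
      rintro _ ⟨i, rfl⟩
      simp [initTapes, κ]
    obtain ⟨T, h3, h4, h5⟩ := Proc.exec_copy hj h1 h2
    refine ⟨T, h3, fun i k => ?_, Proc.timeLE_copy hj h1 h2⟩
    by_cases hk : k = M.input
    · rw [h4 _ ⟨i, by rw [hk]⟩, initTapes, if_pos hk]
    · rw [h5 _ (by simpa [D, κ] using hk) (by simp [κ]), initTapes, initTapes, if_neg hk,
        if_neg (by simp [κ])]
  have hP : ∀ x, (∃ T', (∀ S, P.Exec (initTapes none x) () S ↔ S = T') ∧
        Holds (T' o) (acc x false :: acc x true :: y x)) ∧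
      P.TimeLE (initTapes none x) (2 * x.length + 2 + (p.eval x.length + 1 +
        (p.eval x.length + 1 + 1) + (p.eval x.length + 1 + (p.eval x.length + 1 + 1) +
        (p.eval x.length + 1 + 3)))) := by
    intro x
    obtain ⟨T₀, e0, hT₀, t0⟩ := h₀ x
    set T₁ := Function.extend (κ 0) (c x false).tape T₀
    have hT₁ : ∀ k, T₁ (κ 1 k) = initTapes M.input x k := fun k =>
      (hne (by decide) _ _ _).trans (hT₀ _ _)
    set T₂ := Function.extend (κ 1) (c x true).tape T₁
    have hT₂ : ∀ k, T₂ (κ 2 k) = initTapes M.input x k := fun k =>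
      (hne (by decide) _ _ _).trans ((hne (by decide) _ _ _).trans (hT₀ _ _))
    obtain ⟨⟨T₃, e3, hT₃⟩, t3⟩ := h₃ x (acc x false) (acc x true) T₂ hT₂
    have e1 := hwith x false 0 T₀ (hT₀ 0)
    have e2 := hwith x true 1 T₁ hT₁
    constructor
    · refine ⟨T₃, fun S => ?_, hT₃⟩
      simp only [P, R₁, R₂, Proc.exec_seq, e0]
      constructor
      · rintro ⟨_, _, rfl, _, _, h, h'⟩
        obtain ⟨rfl, rfl⟩ := (e1 _ _).1 h
        obtain ⟨_, _, h, h'⟩ := h'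
        obtain ⟨rfl, rfl⟩ := (e2 _ _).1 h
        exact (e3 _).1 h'
      · intro h
        exact ⟨(), _, rfl, _, _, (e1 _ _).2 ⟨rfl, rfl⟩, _, _, (e2 _ _).2 ⟨rfl, rfl⟩, (e3 _).2 h⟩
    · refine Proc.timeLE_seq t0 fun u S h => ?_
      obtain rfl := (e0 _ _).1 h
      refine Proc.timeLE_seq (Machine.timeLE_runWith (hκ 0) (hT₀ 0) hp) fun u S h => ?_
      obtain ⟨rfl, rfl⟩ := (e1 _ _).1 h
      refine Proc.timeLE_seq (Machine.timeLE_runWith (hκ 1) hT₁ hp) fun u S h => ?_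
      obtain ⟨rfl, rfl⟩ := (e2 _ _).1 h
      exact t3
  refine ⟨P.toMachine none o, Proc.toMachine_oracleFree,
    Proc.toMachine_polyTime (2 * .X + 5 * p + 12) fun x => ?_, fun x => ?_⟩
  · refine (hP x).2.mono ?_
    simp only [Polynomial.eval_add, Polynomial.eval_mul, Polynomial.eval_ofNat, Polynomial.eval_X]
    omega
  · obtain ⟨⟨T', h1, h2⟩, -⟩ := hP x
    constructor
    · exact ⟨⟨inr (), T'⟩, Proc.toMachine_acceptsAt.2 ⟨rfl, (h1 _).2 rfl⟩, h2⟩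
    · intro d hd
      obtain h3 : d.tape = T' := (h1 _).1 (Proc.toMachine_acceptsAt.1 hd).2
      rw [h3]
      exact h2

end SNReduction

/-- `P^{NP[1]} ⊆ R ⊆ DP`, where `R` is the downward closure of NP under 1-truth-table strong
nondeterministic reductions; `R` is closed under complement and contained in `DP ∩ coDP`. -/
theorem corollaryc :
    SNReduction.POneQuery SNReduction.NP ⊆ SNReduction.RSNtt 1 SNReduction.NP ∧
    SNReduction.RSNtt 1 SNReduction.NP ⊆ SNReduction.DP ∧
    (∀ L ∈ SNReduction.RSNtt 1 SNReduction.NP, Lᶜ ∈ SNReduction.RSNtt 1 SNReduction.NP) ∧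
    SNReduction.RSNtt 1 SNReduction.NP ⊆ SNReduction.DP ∩ SNReduction.co SNReduction.DP :=
  ⟨SNReduction.POneQuery_subset_RSNtt, SNReduction.RSNtt_one_subset_DP,
    fun _ => SNReduction.compl_mem_RSNtt, fun _ hL => ⟨SNReduction.RSNtt_one_subset_DP hL,
      SNReduction.RSNtt_one_subset_DP (SNReduction.compl_mem_RSNtt hL)⟩⟩
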